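/- Let $\mathcal H$ be the complex upper half-plane and $q=e^{2\pi i\tau}$, $\tau\in\mathcal H$. Put $\theta(\tau)=\sum_{n\in\mathbb Z}q^{n^2}$ and $\Psi(\tau)=\sum_{n\ge 0}q^{n(n+1)/2}$. Let $v$ and $k$ be positive integers with $v+k$ even, let $b_1,\dots,b_v$ and $c_1,\dots,c_k$ be positive integers, and put $\mathbf h=c_1+\cdots+c_k$ and $$M=\operatorname{lcm}\big[\,4\operatorname{lcm}(b_1,\dots,b_v),\;2\operatorname{lcm}(c_1,\dots,c_k)\,\big].$$ Then the function $$q^{\mathbf h/8}\prod_{i=1}^v\theta(b_i\tau)\prod_{j=1}^k\Psi(c_j\tau),\qquad q^{\mathbf h/8}=e^{2\pi i\tau\mathbf h/8},$$ is a modular form in $M_{(v+k)/2}(\Gamma_0(M),\chi'')$ if and only if $\mathbf h\equiv 0\pmod 8$. Here $\chi''$ is given by the Kronecker symbol $$\chi''=\begin{cases}\left(\dfrac{(-1)^{(v+k)/2}\,4\,\prod_{i=1}^v b_i\prod_{j=1}^k c_j}{\cdot}\right)&\text{if $v$ and $k$ are even},\\[2ex]\left(\dfrac{(-1)^{(v+k)/2}\,8\,\prod_{i=1}^v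 b_i\prod_{j=1}^k c_j}{\cdot}\right)&\text{if $v$ and $k$ are odd},\end{cases}$$ on integers prime to $M$. Membership in $M_w(\Gamma_0(M),\chi'')$ means that these values define a Dirichlet character $\chi''$ modulo $M$ and that the function is holomorphic on $\mathcal H$, satisfies $f\big(\frac{\alpha\tau+\beta}{\gamma\tau+\delta}\big)=\chi''(\delta)(\gamma\tau+\delta)^{w}f(\tau)$ for all $\begin{pmatrix}\alpha&\beta\\ \gamma&\delta\end{pmatrix}\in\Gamma_0(M)$, and is holomorphic at all cusps. -/

import Mathlib

noncomputable section

open UpperHalfPlane ModularForm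
open scoped Manifold

namespace MixedForms

/-- The Kronecker symbol `(a / n)` for integers `a`, `n`, with the usual conventions
`(a / 0) = 1` if `a = ±1` and `0` otherwise, `(a / -1) = -1` if `a < 0` and `1` otherwise,
`(a / 2) = 0` for even `a`, `1` for `a ≡ ±1 mod 8`, `-1` for `a ≡ ±3 mod 8` (this is `ZMod.χ₈`).
The factor at the odd part of `|n|` is the Jacobi symbol. -/
def kroneckerSymbol (a n : ℤ) : ℤ :=
  if n = 0 then (if a.natAbs = 1 then 1 else 0)
  else (if a < 0 ∧ n < 0 then -1 else 1) *
    ZMod.χ₈ (a : ZMod 8) ^ padicValNat 2 n.natAbs *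
    jacobiSym a (n.natAbs / 2 ^ padicValNat 2 n.natAbs)

/-- `θ(τ) = ∑_{n ∈ ℤ} q^{n²}`, `q = exp(2πiτ)`. -/
def theta (τ : ℂ) : ℂ :=
  ∑' n : ℤ, Complex.exp (2 * Real.pi * Complex.I * τ * ((n ^ 2 : ℤ) : ℂ))

/-- `Ψ(τ) = ∑_{n ≥ 0} q^{n(n+1)/2}`, `q = exp(2πiτ)`; the natural number division is exact. -/
def Psi (τ : ℂ) : ℂ :=
  ∑' n : ℕ, Complex.exp (2 * Real.pi * Complex.I * τ * ((n * (n + 1) / 2 : ℕ) : ℂ))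

/-- The space `M_w(Γ₀(N), χ)` of holomorphic modular forms of weight `w` on `Γ₀(N)` with character
`χ` mod `N`: holomorphic functions on the upper half-plane such that
`f((aτ + b)/(cτ + d)) = χ(d) (cτ + d)^w f(τ)` for all matrices in `Γ₀(N)`, and which are
holomorphic at every cusp (every `SL₂(ℤ)`-translate is bounded at `i∞`). -/
def modularFormsWithChar (w : ℤ) (N : ℕ) (χ : DirichletCharacter ℂ N) :
    Submodule ℂ (ℍ → ℂ) where
  carrier := {f | MDiff f ∧
    (∀ γ ∈ CongruenceSubgroup.Gamma0 N, f ∣[w] γ = χ ((γ 1 1 : ℤ) : ZMod N) • f) ∧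
    ∀ γ : Matrix.SpecialLinearGroup (Fin 2) ℤ, IsBoundedAtImInfty (f ∣[w] γ)}
  zero_mem' := by
    refine ⟨mdifferentiable_const, fun γ _ => ?_, fun γ => ?_⟩
    · simp
    · simpa using zero_form_isBoundedAtImInfty
  add_mem' := by
    rintro f g ⟨hf, hf', hf''⟩ ⟨hg, hg', hg''⟩
    refine ⟨hf.add hg, fun γ h => ?_, fun γ => ?_⟩
    · rw [SlashAction.add_slash, hf' γ h, hg' γ h, smul_add]
    · rw [SlashAction.add_slash]
      exact (hf'' γ).add (hg'' γ)
  smul_mem' := by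
    rintro a f ⟨hf, hf', hf''⟩
    refine ⟨hf.const_smul a, fun γ h => ?_, fun γ => ?_⟩
    · rw [ModularForm.SL_smul_slash, hf' γ h, smul_comm]
    · rw [ModularForm.SL_smul_slash]
      exact (hf'' γ).smul a

/-- `q^{h/8} ∏ θ(b_i τ) ∏ Ψ(c_j τ)` with `h = ∑ c_j` and `q^{h/8} = exp(2πiτ h/8)`. -/
def mixedSeries {v k : ℕ} (b : Fin v → ℕ) (c : Fin k → ℕ) (τ : ℍ) : ℂ :=
  Complex.exp (2 * Real.pi * Complex.I * (τ : ℂ) * (((∑ j, c j : ℕ) : ℂ) / 8)) *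
    ((∏ i, theta ((b i : ℂ) * (τ : ℂ))) * ∏ j, Psi ((c j : ℂ) * (τ : ℂ)))

/-- The level `lcm(4 lcm(b_1, …, b_v), 2 lcm(c_1, …, c_k))`. -/
def level {v k : ℕ} (b : Fin v → ℕ) (c : Fin k → ℕ) : ℕ :=
  Nat.lcm (4 * Finset.univ.lcm b) (2 * Finset.univ.lcm c)

/-- The numerator of the Kronecker symbol: `(-1)^{(v+k)/2} · 4 ∏ b_i ∏ c_j` when `v` (hence `k`)
is even, `(-1)^{(v+k)/2} · 8 ∏ b_i ∏ c_j` when `v` (hence `k`) is odd. -/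
def charNumerator {v k : ℕ} (b : Fin v → ℕ) (c : Fin k → ℕ) : ℤ :=
  (-1) ^ ((v + k) / 2) * (if Even v then 4 else 8) * (∏ i, (b i : ℤ)) * ∏ j, (c j : ℤ)

end MixedForms

end

noncomputable section

open UpperHalfPlane ModularForm Filter Topology
open scoped Manifold Real MatrixGroups

namespace MixedForms

/-! Every factor is a theta series with summation index shifted by 0 or 1/2: θ(τ) = ∑ exp(πi n²·2τ)
and q^{1/8}Ψ(τ) = ½ ∑ exp(πi(n + 1/2)²τ). Write F for the product, w = (v + k)/2 and h = ∑ c_j.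

Law up to a constant: SL₂(ℤ) permutes the eighth powers of the three even theta constants in weight
4, with no root of unity left over (`thetaEighth_slash`). The divisibilities built into M make each
factor keep its class, so (F|γ)⁸ = F⁸ on Γ₀(M); since ℍ is connected, F|γ = ζF for a constant ζ
(`exists_mixedSeries_slash_eq`). The same permutation, after reducing diag(m, 1)γ to triangular
form, bounds F at all cusps.

The constant: if the lower right entry of γ is a prime p, let τ → 0 along the imaginary axis. Each
quotient of a factor at γτ by the same factor at τ tends to a quadratic Gauss sum modulo p
(`tendsto_shiftedTheta_smul_div`). The basic sum g occurs v + k = 2w times, and g² = (-1/p)p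
accounts for (-1/p)^w and for the p^w coming from the automorphy factor; the Legendre symbols
assemble to that of `charNumerator`, and the remaining eighth roots of unity multiply to 1 because 8
∣ h. Dirichlet's theorem on primes and invariance under T extend this to positive lower right
entries, and -1 ∈ SL₂(ℤ) to negative ones. As F ≠ 0, the law itself forces the Kronecker symbol to
be periodic and multiplicative.

Conversely T ∈ Γ₀(M) has lower right entry 1, while F|T = e^{2πih/8}F; hence 8 ∣ h. -/

/-! ### θ and Ψ as shifted theta series -/

/-- The theta series `∑_{n ∈ ℤ} exp(πi(n + a)²τ)`. -/
def shiftedTheta (a : ℝ) (τ : ℂ) : ℂ :=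
  Complex.exp (π * Complex.I * a ^ 2 * τ) * jacobiTheta₂ (a * τ) τ

lemma hasSum_shiftedTheta (a : ℝ) {τ : ℂ} (hτ : 0 < τ.im) :
    HasSum (fun n : ℤ => Complex.exp (π * Complex.I * (n + a) ^ 2 * τ)) (shiftedTheta a τ) := by
  refine ((hasSum_jacobiTheta₂_term (a * τ) hτ).mul_left
    (Complex.exp (π * Complex.I * a ^ 2 * τ))).congr_fun ?_
  intro n
  rw [jacobiTheta₂_term, ← Complex.exp_add]
  congr 1
  ring

lemma differentiableAt_shiftedTheta (a : ℝ) {τ : ℂ} (hτ : 0 < τ.im) :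
    DifferentiableAt ℂ (shiftedTheta a) τ := by
  have h1 : DifferentiableAt ℂ (fun p : ℂ × ℂ => jacobiTheta₂ p.1 p.2) ((a : ℂ) * τ, τ) :=
    (hasFDerivAt_jacobiTheta₂ _ hτ).differentiableAt
  have h2 : DifferentiableAt ℂ (fun τ : ℂ => ((a : ℂ) * τ, τ)) τ := by fun_prop
  have h3 : DifferentiableAt ℂ (fun τ : ℂ => jacobiTheta₂ (a * τ) τ) τ :=
    DifferentiableAt.comp (f := fun τ : ℂ => ((a : ℂ) * τ, τ)) τ h1 h2
  unfold shiftedTheta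
  fun_prop

/-- The norm of each term decreases in Im τ, so the series of norms at τ = i is a majorant. -/
lemma exists_norm_shiftedTheta_le (a : ℝ) :
    ∃ C : ℝ, ∀ τ : ℂ, 1 ≤ τ.im → ‖shiftedTheta a τ‖ ≤ C := by
  have hs : Summable fun n : ℤ => ‖Complex.exp (π * Complex.I * (n + a) ^ 2 * Complex.I)‖ :=
    (hasSum_shiftedTheta a (τ := Complex.I) (by simp)).summable.norm
  refine ⟨∑' n : ℤ, ‖Complex.exp (π * Complex.I * (n + a) ^ 2 * Complex.I)‖, fun τ hτ => ?_⟩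
  rw [← (hasSum_shiftedTheta a (by linarith : 0 < τ.im)).tsum_eq]
  refine tsum_of_norm_bounded hs.hasSum fun n => ?_
  have key : ∀ σ : ℂ, (π * Complex.I * (n + a) ^ 2 * σ).re = -(π * (n + a) ^ 2 * σ.im) := by
    intro σ
    have : (π * Complex.I * (n + a) ^ 2 * σ : ℂ) = ((π * (n + a) ^ 2 : ℝ) : ℂ) * (Complex.I * σ) := by
      push_cast; ring
    rw [this, Complex.re_ofReal_mul]
    simp
  rw [Complex.norm_exp, Complex.norm_exp, key, key, Real.exp_le_exp]
  have : 0 ≤ π * (n + a) ^ 2 := by positivity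
  simp only [Complex.I_im]
  nlinarith

/-- Inversion: at z = aτ the exponential factor of the functional equation cancels the prefactor
exp(πia²τ), and the remaining argument a is real. -/
lemma shiftedTheta_eq_jacobiTheta₂ (a : ℝ) {τ : ℂ} (hτ : 0 < τ.im) :
    shiftedTheta a τ = 1 / (-Complex.I * τ) ^ (1 / 2 : ℂ) * jacobiTheta₂ a (-1 / τ) := by
  have h0 : τ ≠ 0 := by rintro rfl; simp at hτ
  rw [shiftedTheta, jacobiTheta₂_functional_equation, mul_div_cancel_right₀ _ h0]
  have : (-π * Complex.I * (a * τ) ^ 2 / τ : ℂ) = -(π * Complex.I * a ^ 2 * τ) := by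
    field_simp
  rw [this, Complex.exp_neg]
  field_simp [Complex.exp_ne_zero]

lemma theta_eq_shiftedTheta {τ : ℂ} (hτ : 0 < τ.im) : theta τ = shiftedTheta 0 (2 * τ) := by
  have h2 : 0 < (2 * τ).im := by simpa using hτ
  rw [← (hasSum_shiftedTheta 0 h2).tsum_eq, theta]
  refine tsum_congr fun n => ?_
  congr 1
  push_cast
  ring

/-- Since n(n+1)/2 + 1/8 = (n + 1/2)²/2 and n ↦ -1 - n preserves (n + 1/2)², the sum over ℤ is twice
the sum over n ≥ 0. -/
lemma exp_mul_Psi {τ : ℂ} (hτ : 0 < τ.im) :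
    Complex.exp (π * Complex.I * τ / 4) * Psi τ = shiftedTheta (1 / 2) τ / 2 := by
  have hS := hasSum_shiftedTheta (1 / 2) hτ
  set f : ℤ → ℂ := fun n => Complex.exp (π * Complex.I * (n + (1 / 2 : ℝ)) ^ 2 * τ) with hf
  have h1 : Summable fun n : ℕ => f n := hS.summable.comp_injective Nat.cast_injective
  have hneg : ∀ n : ℕ, f (-(n + 1)) = f n := by
    intro n
    simp only [hf]
    congr 1
    push_cast
    ring
  have h2 : HasSum (fun n : ℕ => f (-(n + 1))) (∑' n : ℕ, f n) := by
    simp only [hneg]; exact h1.hasSum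
  have h3 := (h1.hasSum.of_nat_of_neg_add_one h2).unique hS
  rw [← h3, ← two_mul, mul_div_cancel_left₀ _ two_ne_zero, Psi, ← tsum_mul_left]
  refine tsum_congr fun n => ?_
  simp only [hf]
  rw [← Complex.exp_add]
  congr 1
  have : ((n * (n + 1) / 2 : ℕ) : ℂ) = (n * (n + 1) : ℂ) / 2 := by
    rw [Nat.cast_div (Nat.even_mul_succ_self n).two_dvd (by norm_num)]
    push_cast
    ring
  rw [this]
  push_cast
  ring

/-- The mixed product in terms of shifted theta series. -/
lemma mixedSeries_eq {v k : ℕ} (b : Fin v → ℕ) (c : Fin k → ℕ) (hb : ∀ i, 0 < b i)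
    (hc : ∀ j, 0 < c j) (τ : ℍ) :
    mixedSeries b c τ = (∏ i, shiftedTheta 0 ((2 * b i : ℕ) * (τ : ℂ))) *
      ∏ j, (shiftedTheta (1 / 2) ((c j : ℂ) * (τ : ℂ)) / 2) := by
  have him : ∀ n : ℕ, 0 < n → 0 < ((n : ℂ) * (τ : ℂ)).im := by
    intro n hn
    have := τ.im_pos
    simp only [Complex.mul_im, Complex.natCast_re, Complex.natCast_im, zero_mul, add_zero]
    exact mul_pos (by exact_mod_cast hn) this
  have hexp : Complex.exp (2 * π * Complex.I * (τ : ℂ) * (((∑ j, c j : ℕ) : ℂ) / 8)) =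
      ∏ j, Complex.exp (π * Complex.I * ((c j : ℂ) * (τ : ℂ)) / 4) := by
    rw [← Complex.exp_sum]
    congr 1
    push_cast
    rw [Finset.sum_div, Finset.mul_sum]
    refine Finset.sum_congr rfl fun j _ => ?_
    ring
  rw [mixedSeries, hexp, mul_left_comm, ← Finset.prod_mul_distrib]
  congr 1
  · refine Finset.prod_congr rfl fun i _ => ?_
    rw [theta_eq_shiftedTheta (him _ (hb i))]
    push_cast
    ring_nf
  · exact Finset.prod_congr rfl fun j _ => exp_mul_Psi (him _ (hc j))

/-! ### Eighth powers of the theta constants under SL₂(ℤ) -/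

lemma shiftedTheta_zero (τ : ℂ) : shiftedTheta 0 τ = jacobiTheta₂ 0 τ := by
  simp [shiftedTheta]

/-- The signs (-1)^n and (-1)^{n²} agree because n(n+1) is even. -/
lemma jacobiTheta₂_half (τ : ℂ) : jacobiTheta₂ (1 / 2) τ = shiftedTheta 0 (τ + 1) := by
  rw [shiftedTheta_zero, jacobiTheta₂, jacobiTheta₂]
  refine tsum_congr fun n => ?_
  rw [jacobiTheta₂_term, jacobiTheta₂_term, Complex.exp_eq_exp_iff_exists_int]
  obtain ⟨l, hl⟩ : Even (n * (n + 1)) := Int.even_mul_succ_self n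
  refine ⟨n - l, ?_⟩
  have hl' : (n * (n + 1) : ℂ) = l + l := by exact_mod_cast hl
  push_cast
  linear_combination (-π * Complex.I) * hl'

lemma shiftedTheta_zero_add_two (τ : ℂ) : shiftedTheta 0 (τ + 2) = shiftedTheta 0 τ := by
  rw [shiftedTheta_zero, shiftedTheta_zero, jacobiTheta₂_add_right]

lemma shiftedTheta_half_add_one {τ : ℂ} (hτ : 0 < τ.im) :
    shiftedTheta (1 / 2) (τ + 1) =
      Complex.exp (π * Complex.I / 4) * shiftedTheta (1 / 2) τ := by
  rw [← (hasSum_shiftedTheta (1 / 2) hτ).tsum_eq,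
    ← (hasSum_shiftedTheta (1 / 2) (τ := τ + 1) (by simpa using hτ)).tsum_eq, ← tsum_mul_left]
  refine tsum_congr fun n => ?_
  rw [← Complex.exp_add, Complex.exp_eq_exp_iff_exists_int]
  obtain ⟨l, hl⟩ : Even (n * (n + 1)) := Int.even_mul_succ_self n
  refine ⟨l, ?_⟩
  have hl' : (n * (n + 1) : ℂ) = l + l := by exact_mod_cast hl
  push_cast
  linear_combination (π * Complex.I) * hl'

lemma cpow_half_pow_eight {τ : ℂ} : ((-Complex.I * τ) ^ (1 / 2 : ℂ)) ^ 8 = τ ^ 4 := by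
  have h : ((-Complex.I * τ) ^ (1 / 2 : ℂ)) ^ 2 = -Complex.I * τ := by
    rw [← Complex.cpow_nat_mul]; norm_num
  calc ((-Complex.I * τ) ^ (1 / 2 : ℂ)) ^ 8 = (((-Complex.I * τ) ^ (1 / 2 : ℂ)) ^ 2) ^ 4 := by ring
    _ = τ ^ 4 := by rw [h, mul_pow, neg_pow, Complex.I_pow_four]; norm_num

/-- The eighth powers of the three even theta constants, indexed by the nonzero classes of `(c, d)`
modulo two. -/
def thetaEighth (c d : ℤ) (τ : ℍ) : ℂ :=
  if Even c then shiftedTheta (1 / 2) τ ^ 8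
  else if Even d then shiftedTheta 0 ((τ : ℂ) + 1) ^ 8 else shiftedTheta 0 τ ^ 8

/-- Inversion exchanges the series with shift 1/2 and the series at τ + 1, and fixes the third; the
eighth power removes the branch of the square root. -/
lemma thetaEighth_slash_S {c d : ℤ} (h : ¬ (Even c ∧ Even d)) :
    thetaEighth c d ∣[(4 : ℤ)] ModularGroup.S = thetaEighth d (-c) := by
  ext τ
  have hτ := τ.im_pos
  have h0 : (τ : ℂ) ≠ 0 := τ.ne_zero
  have hS : ((ModularGroup.S • τ : ℍ) : ℂ) = -1 / (τ : ℂ) := by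
    rw [modular_S_smul]
    simp [neg_div, inv_neg]
  have hS' : 0 < (-1 / (τ : ℂ)).im := hS ▸ (ModularGroup.S • τ).im_pos
  have hSS : -1 / (-1 / (τ : ℂ)) = τ := by field_simp
  have key0 : shiftedTheta 0 τ ^ 8 = (τ : ℂ) ^ (-4 : ℤ) * shiftedTheta 0 (-1 / (τ : ℂ)) ^ 8 := by
    rw [shiftedTheta_eq_jacobiTheta₂ 0 hτ, mul_pow, div_pow, cpow_half_pow_eight,
      shiftedTheta_zero]
    simp [zpow_neg]
  have key2 : ∀ σ : ℂ, 0 < σ.im →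
      shiftedTheta (1 / 2) σ ^ 8 = σ ^ (-4 : ℤ) * shiftedTheta 0 (-1 / σ + 1) ^ 8 := by
    intro σ hσ
    rw [shiftedTheta_eq_jacobiTheta₂ _ hσ, mul_pow, div_pow, cpow_half_pow_eight,
      ← jacobiTheta₂_half]
    simp [zpow_neg]
  have h2 := key2 _ hS'
  rw [hSS] at h2
  rw [SL_slash_apply, thetaEighth, thetaEighth, ModularGroup.denom_S, hS]
  simp only [even_neg] at *
  by_cases hc : Even c <;> by_cases hd : Even d
  · exact absurd ⟨hc, hd⟩ h
  · simp only [hc, hd, if_true, if_false]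
    rw [h2]
    field_simp
  · simp only [hc, hd, if_true, if_false]
    rw [key2 _ hτ, mul_comm]
  · simp only [hc, hd, if_false]
    rw [key0, mul_comm]

lemma thetaEighth_slash_T {c d : ℤ} :
    thetaEighth c d ∣[(4 : ℤ)] ModularGroup.T = thetaEighth c (c + d) := by
  ext τ
  have hT : ((ModularGroup.T • τ : ℍ) : ℂ) = τ + 1 := by
    rw [modular_T_smul]
    simp [add_comm]
  have hden : denom ModularGroup.T τ = 1 := by
    rw [ModularGroup.denom_apply]; simp [ModularGroup.T]
  rw [SL_slash_apply, thetaEighth, thetaEighth, hT, hden]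
  simp only [one_zpow, mul_one]
  by_cases hc : Even c
  · simp only [hc, if_true]
    rw [shiftedTheta_half_add_one τ.im_pos, mul_pow, ← Complex.exp_nat_mul]
    have : ((8 : ℕ) * (π * Complex.I / 4) : ℂ) = 2 * π * Complex.I := by push_cast; ring
    rw [this, Complex.exp_two_pi_mul_I, one_mul]
  · by_cases hd : Even d
    · have : ¬ Even (c + d) := by grind
      simp only [hc, hd, this, if_true, if_false]
      rw [add_assoc, one_add_one_eq_two, shiftedTheta_zero_add_two]
    · have : Even (c + d) := by grind
      simp only [hc, hd, this, if_true, if_false]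

/-- The index is the row vector (c, d) modulo 2 with γ acting from the right, so only the generators
S, T and their inverses need checking. -/
theorem thetaEighth_slash (γ : SL(2, ℤ)) {c d : ℤ} (h : ¬ (Even c ∧ Even d)) :
    thetaEighth c d ∣[(4 : ℤ)] γ =
      thetaEighth (c * γ 0 0 + d * γ 1 0) (c * γ 0 1 + d * γ 1 1) := by
  have hγ : γ ∈ Subgroup.closure {ModularGroup.S, ModularGroup.T} := by
    simp [SpecialLinearGroup.SL2Z_generators]
  induction hγ using Subgroup.closure_induction_left generalizing c d with
  | one => simp
  | mul_left x hx y _ ih =>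
    rw [SlashAction.slash_mul]
    rcases hx with rfl | rfl
    · rw [thetaEighth_slash_S h, ih (by simpa [and_comm] using h)]
      simp only [Matrix.SpecialLinearGroup.coe_mul, Matrix.mul_apply, Fin.sum_univ_two, ModularGroup.coe_S]
      simp
      congr 1 <;> ring
    · rw [thetaEighth_slash_T, ih (by grind)]
      simp only [Matrix.SpecialLinearGroup.coe_mul, Matrix.mul_apply, Fin.sum_univ_two, ModularGroup.coe_T]
      simp
      congr 1 <;> ring
  | inv_mul_cancel x hx y _ ih =>
    rw [SlashAction.slash_mul]
    rcases hx with rfl | rfl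
    · have h1 : thetaEighth c d ∣[(4 : ℤ)] ModularGroup.S⁻¹ = thetaEighth (-d) c := by
        have h2 := thetaEighth_slash_S (c := -d) (d := c) (by simpa [and_comm] using h)
        rw [neg_neg] at h2
        rw [← h2, ← SlashAction.slash_mul, mul_inv_cancel, SlashAction.slash_one]
      rw [h1, ih (by simpa [and_comm] using h)]
      simp only [Matrix.SpecialLinearGroup.coe_mul, Matrix.mul_apply, Fin.sum_univ_two,
        Matrix.SpecialLinearGroup.coe_inv, Matrix.adjugate_fin_two, ModularGroup.coe_S]
      simp
      congr 1 <;> ring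
    · have h1 : thetaEighth c d ∣[(4 : ℤ)] ModularGroup.T⁻¹ = thetaEighth c (d - c) := by
        have h2 := thetaEighth_slash_T (c := c) (d := d - c)
        rw [add_sub_cancel] at h2
        rw [← h2, ← SlashAction.slash_mul, mul_inv_cancel, SlashAction.slash_one]
      rw [h1, ih (by grind)]
      simp only [Matrix.SpecialLinearGroup.coe_mul, Matrix.mul_apply, Fin.sum_univ_two,
        Matrix.SpecialLinearGroup.coe_inv, Matrix.adjugate_fin_two, ModularGroup.coe_T]
      simp
      congr 1 <;> ring

lemma exists_norm_thetaEighth_le (c d : ℤ) :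
    ∃ C : ℝ, ∀ τ : ℍ, 1 ≤ τ.im → ‖thetaEighth c d τ‖ ≤ C := by
  obtain ⟨C₀, h₀⟩ := exists_norm_shiftedTheta_le 0
  obtain ⟨C₁, h₁⟩ := exists_norm_shiftedTheta_le (1 / 2)
  refine ⟨max (C₀ ^ 8) (C₁ ^ 8), fun τ hτ => ?_⟩
  unfold thetaEighth
  split_ifs
  · rw [norm_pow]
    exact (pow_le_pow_left₀ (norm_nonneg _) (h₁ _ hτ) 8).trans (le_max_right _ _)
  · rw [norm_pow]
    exact (pow_le_pow_left₀ (norm_nonneg _) (h₀ _ (by simpa using hτ)) 8).trans (le_max_left _ _)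
  · rw [norm_pow]
    exact (pow_le_pow_left₀ (norm_nonneg _) (h₀ _ hτ) 8).trans (le_max_left _ _)

/-! ### Theta constants at a multiple of the argument -/

/-- Compatibility of the Möbius action with an identity
`diag(m, 1) γ = γ' (A B; 0 D)` of integral matrices. -/
lemma smul_eq_of_mul_eq {γ γ' : SL(2, ℤ)} {m A B D : ℤ} (hD : 0 < D)
    (h₀ : m * γ 0 0 = γ' 0 0 * A) (h₁ : m * γ 0 1 = γ' 0 0 * B + γ' 0 1 * D)
    (h₂ : γ 1 0 = γ' 1 0 * A) (h₃ : γ 1 1 = γ' 1 0 * B + γ' 1 1 * D) {τ τ' : ℍ}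
    (hτ : (τ' : ℂ) = (A * τ + B) / D) :
    ((γ' • τ' : ℍ) : ℂ) = m * ((γ • τ : ℍ) : ℂ) ∧ denom γ τ = D * denom γ' τ' := by
  have hD' : (D : ℂ) ≠ 0 := by exact_mod_cast hD.ne'
  have hden : denom γ τ = D * denom γ' τ' := by
    rw [ModularGroup.denom_apply, ModularGroup.denom_apply, hτ]
    have h₂' : (γ 1 0 : ℂ) = γ' 1 0 * A := by exact_mod_cast h₂
    have h₃' : (γ 1 1 : ℂ) = γ' 1 0 * B + γ' 1 1 * D := by exact_mod_cast h₃
    rw [h₂', h₃']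
    field_simp
    ring
  refine ⟨?_, hden⟩
  have hn : denom γ τ ≠ 0 := denom_ne_zero _ _
  have hn' : denom γ' τ' ≠ 0 := denom_ne_zero _ _
  rw [coe_specialLinearGroup_apply, coe_specialLinearGroup_apply]
  have e1 : ((algebraMap ℤ ℝ (γ 1 0) : ℂ) * τ + (algebraMap ℤ ℝ (γ 1 1) : ℂ)) = denom γ τ := by
    rw [ModularGroup.denom_apply]; simp
  have e2 : ((algebraMap ℤ ℝ (γ' 1 0) : ℂ) * τ' + (algebraMap ℤ ℝ (γ' 1 1) : ℂ)) =
      denom γ' τ' := by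
    rw [ModularGroup.denom_apply]; simp
  rw [e1, e2, hden]
  have h₀' : (m * γ 0 0 : ℂ) = γ' 0 0 * A := by exact_mod_cast h₀
  have h₁' : (m * γ 0 1 : ℂ) = γ' 0 0 * B + γ' 0 1 * D := by exact_mod_cast h₁
  rw [div_eq_iff hn', ← mul_div_assoc, div_mul_eq_mul_div, eq_div_iff (mul_ne_zero hD' hn')]
  generalize denom γ' τ' = δ at hn' ⊢
  rw [hτ]
  simp only [eq_intCast, Complex.ofReal_intCast]
  field_simp
  linear_combination (-(τ : ℂ)) * h₀' - h₁'

/-- The point `mτ` of the upper half-plane. -/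
def natScale (m : ℕ) (hm : 0 < m) (τ : ℍ) : ℍ :=
  ⟨(m : ℂ) * τ, by
    rw [← Complex.ofReal_natCast, Complex.im_ofReal_mul]
    exact mul_pos (by exact_mod_cast hm) τ.im_pos⟩

@[simp] lemma coe_natScale (m : ℕ) (hm : 0 < m) (τ : ℍ) :
    (natScale m hm τ : ℂ) = (m : ℂ) * τ := rfl

/-- Hermite normal form of diag(m, 1)γ: A is the gcd of the first column, the primitive column
obtained by dividing by A is completed to γ' by Bézout, and AD = m gives D > 0. -/
lemma exists_diag_mul_eq (γ : SL(2, ℤ)) {m : ℕ} (hm : 0 < m) :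
    ∃ (γ' : SL(2, ℤ)) (A B D : ℤ), 0 < A ∧ 0 < D ∧ m * γ 0 0 = γ' 0 0 * A ∧
      m * γ 0 1 = γ' 0 0 * B + γ' 0 1 * D ∧ γ 1 0 = γ' 1 0 * A ∧
      γ 1 1 = γ' 1 0 * B + γ' 1 1 * D := by
  have hdet : γ 0 0 * γ 1 1 - γ 0 1 * γ 1 0 = 1 := by
    rw [← Matrix.det_fin_two]; exact γ.det_coe
  have hm' : (0 : ℤ) < m := by exact_mod_cast hm
  have hg : 0 < Int.gcd (m * γ 0 0) (γ 1 0) := by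
    rw [Int.gcd_pos_iff]
    by_contra! h
    obtain ⟨h1, h2⟩ := h
    have : γ 0 0 = 0 := by simpa [hm.ne'] using h1
    rw [this, h2] at hdet
    simp at hdet
  obtain ⟨p, q, hpq, hp, hq⟩ := Int.exists_gcd_one hg
  set g : ℤ := (Int.gcd (m * γ 0 0) (γ 1 0) : ℤ) with hgdef
  have hg' : 0 < g := Int.natCast_pos.mpr hg
  obtain ⟨s, r, hsr⟩ := Int.isCoprime_iff_gcd_eq_one.mpr hpq
  refine ⟨⟨!![p, -r; q, s], by rw [Matrix.det_fin_two_of]; linarith⟩, g,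
    s * (m * γ 0 1) + r * γ 1 1, p * γ 1 1 - q * (m * γ 0 1), hg', ?_, hp, ?_, hq, ?_⟩
  · have : g * (p * γ 1 1 - q * (m * γ 0 1)) = m := by
      linear_combination (-(γ 1 1)) * hp + (m * γ 0 1) * hq + m * hdet
    by_contra! hle
    nlinarith
  · show (m : ℤ) * γ 0 1 = p * (s * (m * γ 0 1) + r * γ 1 1) + -r * (p * γ 1 1 - q * (m * γ 0 1))
    linear_combination (-(m * γ 0 1)) * hsr
  · show γ 1 1 = q * (s * (m * γ 0 1) + r * γ 1 1) + s * (p * γ 1 1 - q * (m * γ 0 1))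
    linear_combination (-(γ 1 1)) * hsr

/-- Growth of the eighth powers at an arbitrary cusp. -/
theorem exists_norm_thetaEighth_smul_le (γ : SL(2, ℤ)) {m : ℕ} (hm : 0 < m) {c d : ℤ}
    (h : ¬ (Even c ∧ Even d)) : ∃ C Y : ℝ, ∀ τ : ℍ, Y ≤ τ.im →
      ‖thetaEighth c d (natScale m hm (γ • τ))‖ ≤ C * ‖denom γ τ‖ ^ 4 := by
  obtain ⟨γ', A, B, D, hA, hD, h₀, h₁, h₂, h₃⟩ := exists_diag_mul_eq γ hm
  obtain ⟨C, hC⟩ := exists_norm_thetaEighth_le (c * γ' 0 0 + d * γ' 1 0) (c * γ' 0 1 + d * γ' 1 1)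
  have hA' : (0 : ℝ) < A := by exact_mod_cast hA
  have hD' : (0 : ℝ) < D := by exact_mod_cast hD
  have him : ∀ τ : ℍ, ((A * τ + B : ℂ) / D).im = A / D * τ.im := by
    intro τ
    have : ((A * τ + B : ℂ) / D) = ((A / D : ℝ) : ℂ) * τ + ((B / D : ℝ) : ℂ) := by
      push_cast; field_simp
    rw [this, Complex.add_im, Complex.im_ofReal_mul, Complex.ofReal_im, add_zero]
    rfl
  refine ⟨C / D ^ 4, D / A, fun τ hτ => ?_⟩
  have hpos : 0 < ((A * τ + B : ℂ) / D).im := by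
    rw [him]; exact mul_pos (by positivity) τ.im_pos
  obtain ⟨e1, e2⟩ := smul_eq_of_mul_eq (m := m) hD h₀ h₁ h₂ h₃ (τ := τ)
    (τ' := ⟨(A * τ + B : ℂ) / D, hpos⟩) rfl
  set τ' : ℍ := ⟨(A * τ + B : ℂ) / D, hpos⟩ with hτ'
  have e3 : natScale m hm (γ • τ) = γ' • τ' := by
    apply UpperHalfPlane.ext
    rw [e1, coe_natScale]
    simp
  have e4 := congrFun (thetaEighth_slash γ' h) τ'
  have hn' : denom γ' τ' ≠ 0 := denom_ne_zero _ _
  rw [SL_slash_apply, zpow_neg, ← div_eq_mul_inv, div_eq_iff (zpow_ne_zero _ hn')] at e4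
  rw [e3, e4, e2, norm_mul, norm_mul, norm_zpow, Complex.norm_intCast, abs_of_pos hD', mul_pow,
    zpow_ofNat]
  have h1 : 1 ≤ τ'.im := by
    have : τ'.im = A / D * τ.im := him τ
    rw [this, div_mul_eq_mul_div, one_le_div hD']
    rw [div_le_iff₀ hA'] at hτ
    linarith
  have e5 : C / (D : ℝ) ^ 4 * ((D : ℝ) ^ 4 * ‖denom γ' τ'‖ ^ 4) = C * ‖denom γ' τ'‖ ^ 4 := by
    field_simp
  rw [e5]
  exact mul_le_mul_of_nonneg_right (hC τ' h1) (by positivity)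

/-- Transformation of the eighth powers at a multiple of the argument. -/
theorem thetaEighth_natScale_smul (γ : SL(2, ℤ)) {m : ℕ} (hm : 0 < m) {c d : ℤ}
    (h : ¬ (Even c ∧ Even d)) {l : ℤ} (hl : γ 1 0 = l * m) (τ : ℍ) :
    thetaEighth c d (natScale m hm (γ • τ)) =
      denom γ τ ^ 4 * thetaEighth (c * γ 0 0 + d * l) (c * (m * γ 0 1) + d * γ 1 1)
        (natScale m hm τ) := by
  have hdet : γ 0 0 * γ 1 1 - γ 0 1 * γ 1 0 = 1 := by
    rw [← Matrix.det_fin_two]; exact γ.det_coe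
  let γ' : SL(2, ℤ) := ⟨!![γ 0 0, m * γ 0 1; l, γ 1 1], by
    rw [Matrix.det_fin_two_of]; linear_combination hdet + (γ 0 1) * hl⟩
  have g00 : γ' 0 0 = γ 0 0 := rfl
  have g01 : γ' 0 1 = m * γ 0 1 := rfl
  have g10 : γ' 1 0 = l := rfl
  have g11 : γ' 1 1 = γ 1 1 := rfl
  obtain ⟨e1, e2⟩ := smul_eq_of_mul_eq (γ := γ) (γ' := γ') (m := m) (A := m) (B := 0) (D := 1)
    one_pos (by rw [g00]; ring) (by rw [g01]; ring) (by rw [g10, hl])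
    (by rw [g11]; ring) (τ := τ) (τ' := natScale m hm τ) (by simp)
  have e3 : natScale m hm (γ • τ) = γ' • natScale m hm τ := by
    apply UpperHalfPlane.ext
    rw [e1, coe_natScale]
    simp
  have e4 := congrFun (thetaEighth_slash γ' h) (natScale m hm τ)
  have hn' : denom γ' (natScale m hm τ) ≠ 0 := denom_ne_zero _ _
  rw [SL_slash_apply, zpow_neg, ← div_eq_mul_inv, div_eq_iff (zpow_ne_zero _ hn')] at e4
  rw [e3, e4, e2, g00, g01, g10, g11, Int.cast_one, one_mul, mul_comm]
  norm_cast

/-! ### Behaviour near the cusps: theta quotients and Gauss sums -/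

/-- Split n = r + dk by residues: by `hper` the phase at ρ depends on r alone, and the sum over k is
again a shifted theta series. -/
lemma shiftedTheta_add_eq_sum (a ρ : ℝ) {d : ℕ} (hd : 0 < d)
    (hper : ∀ n k : ℤ, Complex.exp (π * Complex.I * (n + d * k + a) ^ 2 * ρ) =
      Complex.exp (π * Complex.I * (n + a) ^ 2 * ρ)) {w : ℂ} (hw : 0 < w.im) :
    shiftedTheta a (ρ + w) = ∑ r : Fin d, Complex.exp (π * Complex.I * ((r : ℕ) + a) ^ 2 * ρ) *
      shiftedTheta (((r : ℕ) + a) / d) (d ^ 2 * w) := by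
  have : NeZero d := ⟨hd.ne'⟩
  have hd0 : (d : ℂ) ≠ 0 := by exact_mod_cast hd.ne'
  have h1 := hasSum_shiftedTheta a (τ := ρ + w) (by simpa using hw)
  rw [← (Int.divModEquiv d).symm.hasSum_iff, ← (Equiv.prodComm _ _).hasSum_iff] at h1
  have hw' : 0 < ((d : ℂ) ^ 2 * w).im := by
    have : ((d : ℂ) ^ 2 * w) = ((d ^ 2 : ℝ) : ℂ) * w := by push_cast; ring
    rw [this, Complex.im_ofReal_mul]
    have : (0 : ℝ) < d := by exact_mod_cast hd
    positivity
  refine ((hasSum_fintype _).unique (h1.prod_fiberwise fun r => ?_)).symm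
  refine ((hasSum_shiftedTheta (((r : ℕ) + a) / d) hw').mul_left _).congr_fun fun k => ?_
  have h2 := hper (r : ℕ) k
  have e : ((Int.divModEquiv d).symm (k, r) : ℤ) = (r : ℕ) + d * k := by
    simp [Int.divModEquiv]; ring
  simp only [Function.comp_apply, Equiv.prodComm_apply, Prod.swap_prod_mk, e]
  push_cast at h2 ⊢
  rw [mul_add, Complex.exp_add, h2]
  congr 2
  field_simp
  ring

/-- Only the term n = 0 survives, by dominated convergence against the terms at τ = i; a real x does
not affect norms. -/
lemma tendsto_jacobiTheta₂_one (x : ℝ) {σ : ℕ → ℂ}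
    (hσ : Tendsto (fun n => (σ n).im) atTop atTop) :
    Tendsto (fun n => jacobiTheta₂ x (σ n)) atTop (𝓝 1) := by
  have hb : Summable fun n : ℤ => ‖jacobiTheta₂_term n 0 Complex.I‖ :=
    (hasSum_jacobiTheta₂_term 0 (by simp)).summable.norm
  have hnorm : ∀ (n : ℤ) (τ : ℂ), ‖jacobiTheta₂_term n x τ‖ = Real.exp (-(π * n ^ 2 * τ.im)) := by
    intro n τ
    rw [norm_jacobiTheta₂_term]
    simp
  have h1 : (1 : ℂ) = ∑' n : ℤ, if n = 0 then 1 else 0 := by rw [tsum_ite_eq]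
  rw [h1]
  refine tendsto_tsum_of_dominated_convergence hb (fun n => ?_) ?_
  · split_ifs with hn
    · subst hn
      simp [jacobiTheta₂_term]
    · rw [tendsto_zero_iff_norm_tendsto_zero]
      simp only [hnorm]
      refine Real.tendsto_exp_neg_atTop_nhds_zero.comp (hσ.const_mul_atTop ?_)
      have : (n : ℝ) ≠ 0 := by exact_mod_cast hn
      positivity
  · filter_upwards [hσ.eventually_ge_atTop 1] with k hk n
    rw [hnorm, norm_jacobiTheta₂_term, Real.exp_le_exp]
    have : 0 ≤ π * (n : ℝ) ^ 2 := by positivity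
    simp only [Complex.I_im, Complex.zero_im]
    nlinarith

/-- The points `i/(n+1)`, tending to the cusp `0`. -/
def cuspSeq (n : ℕ) : ℍ := ⟨((1 / (n + 1) : ℝ) : ℂ) * Complex.I, by
  rw [Complex.im_ofReal_mul, Complex.I_im, mul_one]; positivity⟩

lemma coe_cuspSeq (n : ℕ) : (cuspSeq n : ℂ) = ((1 / (n + 1) : ℝ) : ℂ) * Complex.I := rfl

lemma tendsto_cuspSeq : Tendsto (fun n => (cuspSeq n : ℂ)) atTop (𝓝 0) := by
  have h := (Complex.continuous_ofReal.tendsto 0).comp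
    (tendsto_one_div_add_atTop_nhds_zero_nat (𝕜 := ℝ))
  simpa [coe_cuspSeq] using h.mul_const Complex.I

lemma neg_I_mul_cuspSeq (m n : ℕ) :
    -Complex.I * (m * cuspSeq n) = ((m / (n + 1) : ℝ) : ℂ) := by
  rw [coe_cuspSeq]
  push_cast
  linear_combination (-(m / (n + 1) : ℂ)) * Complex.I_mul_I

lemma neg_one_div_mul_cuspSeq {m : ℕ} (n : ℕ) :
    -1 / (m * cuspSeq n : ℂ) = (((n + 1) / m : ℝ) : ℂ) * Complex.I := by
  have h : (n + 1 : ℂ) ≠ 0 := by exact_mod_cast n.succ_ne_zero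
  rw [coe_cuspSeq]
  rcases eq_or_ne m 0 with rfl | hm
  · simp
  have hm' : (m : ℂ) ≠ 0 := by exact_mod_cast hm
  push_cast
  field_simp
  rw [Complex.I_sq]

lemma tendsto_im_div {m : ℕ} (hm : 0 < m) :
    Tendsto (fun n : ℕ => ((n + 1) / m : ℝ)) atTop atTop := by
  have hm' : (0 : ℝ) < m := by exact_mod_cast hm
  exact (tendsto_atTop_add_const_right _ 1 tendsto_natCast_atTop_atTop).atTop_div_const hm'

lemma natCast_mul_im_pos {m : ℕ} (hm : 0 < m) (τ : ℍ) : 0 < ((m : ℂ) * τ).im :=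
  (natScale m hm τ).im_pos

/-- Inversion moves mi/(n+1) to i(n+1)/m, where the theta series tends to 1. This permits division
by the factors along the sequence. -/
lemma eventually_shiftedTheta_ne_zero (a : ℝ) {m : ℕ} (hm : 0 < m) :
    ∀ᶠ n in atTop, shiftedTheta a (m * cuspSeq n) ≠ 0 := by
  have h : Tendsto (fun n => jacobiTheta₂ a (-1 / (m * cuspSeq n : ℂ))) atTop (𝓝 1) := by
    refine tendsto_jacobiTheta₂_one a ?_
    simp only [neg_one_div_mul_cuspSeq, Complex.im_ofReal_mul, Complex.I_im, mul_one]
    exact tendsto_im_div hm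
  filter_upwards [h.eventually_ne one_ne_zero] with n hn
  rw [shiftedTheta_eq_jacobiTheta₂ a (natCast_mul_im_pos hm _), neg_I_mul_cuspSeq]
  refine mul_ne_zero (one_div_ne_zero ?_) hn
  rw [Ne, Complex.cpow_eq_zero_iff]
  rintro ⟨h0, -⟩
  have : (0 : ℝ) < m / (n + 1) := by
    have : (0 : ℝ) < m := by exact_mod_cast hm
    positivity
  exact this.ne' (by exact_mod_cast h0)

lemma ofReal_mul_cpow {x : ℝ} (hx : 0 < x) {z : ℂ} (hz : z ≠ 0) (s : ℂ) :
    ((x : ℂ) * z) ^ s = (x : ℂ) ^ s * z ^ s := by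
  have hx' : (x : ℂ) ≠ 0 := by exact_mod_cast hx.ne'
  rw [Complex.cpow_def_of_ne_zero (mul_ne_zero hx' hz), Complex.cpow_def_of_ne_zero hx',
    Complex.cpow_def_of_ne_zero hz, Complex.log_ofReal_mul hx hz, ← Complex.exp_add,
    Complex.ofReal_log hx.le]
  ring_nf

/-- Comparison of a theta series near a rational point and near `0`: the quotient tends to a
quadratic Gauss sum. -/
theorem tendsto_shiftedTheta_smul_div (a : ℝ) {m d : ℕ} (hm : 0 < m) (hd : 0 < d) (γ : SL(2, ℤ))
    (hγ : γ 1 1 = d)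
    (hper : ∀ n k : ℤ, Complex.exp (π * Complex.I * (n + d * k + a) ^ 2 *
        ((m * γ 0 1 / d : ℝ) : ℂ)) =
      Complex.exp (π * Complex.I * (n + a) ^ 2 * ((m * γ 0 1 / d : ℝ) : ℂ))) :
    Tendsto (fun n => shiftedTheta a (m * ((γ • cuspSeq n : ℍ) : ℂ)) /
        shiftedTheta a (m * cuspSeq n)) atTop
      (𝓝 (∑ r : Fin d, Complex.exp (π * Complex.I * ((r : ℕ) + a) ^ 2 *
        ((m * γ 0 1 / d : ℝ) : ℂ)))) := by
  have hdet : γ 0 0 * γ 1 1 - γ 0 1 * γ 1 0 = 1 := by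
    rw [← Matrix.det_fin_two]; exact γ.det_coe
  have hdet' : (γ 0 0 * d - γ 0 1 * γ 1 0 : ℂ) = 1 := by rw [hγ] at hdet; exact_mod_cast hdet
  have hd0 : (d : ℂ) ≠ 0 := by exact_mod_cast hd.ne'
  have hm0 : (m : ℂ) ≠ 0 := by exact_mod_cast hm.ne'
  set ρ : ℝ := m * γ 0 1 / d with hρ
  -- With τ = `cuspSeq n`, one has d²(mγτ - ρ) = mτδ with δ → 1. As -imτ is a positive real, its
  -- square root splits off and cancels in the quotient, leaving δ^{1/2}.
  set δ : ℕ → ℂ := fun n => d / (γ 1 0 * cuspSeq n + d) with hδ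
  have hden : ∀ n, (γ 1 0 * cuspSeq n + d : ℂ) ≠ 0 := by
    intro n
    have := denom_ne_zero γ (cuspSeq n)
    rw [ModularGroup.denom_apply, hγ] at this
    simpa using this
  have hδ0 : ∀ n, δ n ≠ 0 := fun n => div_ne_zero hd0 (hden n)
  have hδlim : Tendsto (fun n => 1 / (δ n) ^ (1 / 2 : ℂ)) atTop (𝓝 1) := by
    have h1 : Tendsto δ atTop (𝓝 1) := by
      have := (tendsto_const_nhds (x := (d : ℂ))).div
        ((tendsto_cuspSeq.const_mul (γ 1 0 : ℂ)).add_const (d : ℂ)) (by simpa using hd0)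
      rw [mul_zero, zero_add, div_self hd0] at this
      exact this
    have h2 := ((continuousAt_cpow_const (b := (1 / 2 : ℂ)) Complex.one_mem_slitPlane).tendsto.comp
      h1).inv₀ (by simp)
    simpa using h2
  set w : ℕ → ℂ := fun n => m * ((γ • cuspSeq n : ℍ) : ℂ) - ρ with hw
  have hwim : ∀ n, 0 < (w n).im := by
    intro n
    simpa [hw] using natCast_mul_im_pos hm (γ • cuspSeq n)
  have hweq : ∀ n, (d : ℂ) ^ 2 * w n = m * cuspSeq n * δ n := by
    intro n
    have h0 := hden n
    simp only [hw, hδ, hρ]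
    rw [coe_specialLinearGroup_apply, hγ]
    simp only [eq_intCast, Complex.ofReal_intCast, Int.cast_natCast, Complex.ofReal_natCast]
    push_cast
    generalize hX : (γ 1 0 * cuspSeq n + d : ℂ) = X at h0 ⊢
    field_simp
    rw [← hX]
    linear_combination (cuspSeq n : ℂ) * hdet'
  have hdw : ∀ n, 0 < ((d : ℂ) ^ 2 * w n).im := by
    intro n
    have : ((d : ℂ) ^ 2 * w n) = ((d ^ 2 : ℝ) : ℂ) * w n := by push_cast; ring
    rw [this, Complex.im_ofReal_mul]
    have : (0 : ℝ) < d := by exact_mod_cast hd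
    exact mul_pos (by positivity) (hwim n)
  have hxpos : ∀ n : ℕ, (0 : ℝ) < m / (n + 1) := by
    intro n
    have : (0 : ℝ) < m := by exact_mod_cast hm
    positivity
  -- After inversion the numerator's argument differs from the denominator's only by a real
  -- translation, so both imaginary parts tend to infinity.
  have hinv : ∀ n, -1 / ((d : ℂ) ^ 2 * w n) =
      (((n + 1) / m : ℝ) : ℂ) * Complex.I + ((-(γ 1 0) / (d * m) : ℝ) : ℂ) := by
    intro n
    have h0 := hden n
    have h1 : (cuspSeq n : ℂ) ≠ 0 := (cuspSeq n).ne_zero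
    rw [← neg_one_div_mul_cuspSeq, hweq]
    simp only [hδ]
    push_cast
    field_simp
    ring
  have hlim : ∀ x : ℝ, Tendsto (fun n => jacobiTheta₂ x (-1 / ((d : ℂ) ^ 2 * w n))) atTop (𝓝 1) := by
    intro x
    refine tendsto_jacobiTheta₂_one x ?_
    simp only [hinv, Complex.add_im, Complex.im_ofReal_mul, Complex.I_im, mul_one,
      Complex.ofReal_im, add_zero]
    exact tendsto_im_div hm
  have hlim' : Tendsto (fun n => jacobiTheta₂ a (-1 / (m * cuspSeq n : ℂ))) atTop (𝓝 1) := by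
    refine tendsto_jacobiTheta₂_one a ?_
    simp only [neg_one_div_mul_cuspSeq, Complex.im_ofReal_mul, Complex.I_im, mul_one]
    exact tendsto_im_div hm
  have hmain : ∀ n, shiftedTheta a (m * ((γ • cuspSeq n : ℍ) : ℂ)) / shiftedTheta a (m * cuspSeq n) =
      1 / (δ n) ^ (1 / 2 : ℂ) * ((∑ r : Fin d, Complex.exp (π * Complex.I * ((r : ℕ) + a) ^ 2 * ρ) *
        jacobiTheta₂ (((r : ℕ) + a) / d : ℝ) (-1 / ((d : ℂ) ^ 2 * w n))) /
        jacobiTheta₂ a (-1 / (m * cuspSeq n : ℂ))) := by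
    intro n
    have e1 : (m * ((γ • cuspSeq n : ℍ) : ℂ)) = ρ + w n := by simp [hw]
    rw [e1, shiftedTheta_add_eq_sum a ρ hd hper (hwim n),
      shiftedTheta_eq_jacobiTheta₂ a (natCast_mul_im_pos hm _)]
    simp only [shiftedTheta_eq_jacobiTheta₂ _ (hdw n)]
    have e2 : -Complex.I * ((d : ℂ) ^ 2 * w n) = ((m / (n + 1) : ℝ) : ℂ) * δ n := by
      rw [hweq, ← neg_I_mul_cuspSeq]; ring
    rw [e2, neg_I_mul_cuspSeq, ofReal_mul_cpow (hxpos n) (hδ0 n)]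
    have hx0 : (((m / (n + 1) : ℝ) : ℂ)) ^ (1 / 2 : ℂ) ≠ 0 := by
      rw [Ne, Complex.cpow_eq_zero_iff]
      rintro ⟨h0, -⟩
      exact (hxpos n).ne' (by exact_mod_cast h0)
    generalize (((m / (n + 1) : ℝ) : ℂ)) ^ (1 / 2 : ℂ) = X at hx0 ⊢
    simp only [← mul_assoc, mul_comm _ (1 / (X * δ n ^ (1 / 2 : ℂ)))]
    simp only [mul_assoc]
    rw [← Finset.mul_sum]
    rw [mul_div_mul_comm]
    congr 1
    field_simp
  have hsum := tendsto_finsetSum (Finset.univ : Finset (Fin d)) fun r _ =>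
    (hlim (((r : ℕ) + a) / d : ℝ)).const_mul
      (Complex.exp (π * Complex.I * ((r : ℕ) + a) ^ 2 * ρ))
  have := hδlim.mul (hsum.div hlim' one_ne_zero)
  simp only [mul_one, div_one, one_mul] at this
  refine this.congr fun n => ?_
  rw [hmain]
  rfl

/-! ### Quadratic Gauss sums modulo an odd prime -/

section GaussSums

variable (p : ℕ) [Fact p.Prime]

/-- The quadratic character modulo `p` with complex values. -/
def complexQuadraticChar : MulChar (ZMod p) ℂ :=
  (quadraticChar (ZMod p)).ringHomComp (Int.castRingHom ℂ)

lemma complexQuadraticChar_intCast (x : ℤ) :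
    complexQuadraticChar p (x : ZMod p) = (legendreSym p x : ℂ) := rfl

variable {p}

lemma ringChar_zmod_ne_two (hp : p ≠ 2) : ringChar (ZMod p) ≠ 2 := by
  rwa [ZMod.ringChar_zmod_n]

/-- A residue a has 1 + (a/p) square roots; the constant 1 contributes a vanishing character sum,
and rescaling by x extracts (x/p). -/
lemma sum_stdAddChar_mul_sq (hp : p ≠ 2) {x : ℤ} (hx : (x : ZMod p) ≠ 0) :
    ∑ r : ZMod p, ZMod.stdAddChar ((x : ZMod p) * r ^ 2) =
      legendreSym p x * gaussSum (complexQuadraticChar p) ZMod.stdAddChar := by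
  have h1 : ∑ r : ZMod p, ZMod.stdAddChar ((x : ZMod p) * r ^ 2) =
      ∑ a : ZMod p, (complexQuadraticChar p a + 1) * ZMod.stdAddChar ((x : ZMod p) * a) := by
    rw [← Finset.sum_fiberwise Finset.univ (fun r : ZMod p => r ^ 2)]
    refine Finset.sum_congr rfl fun a _ => ?_
    rw [Finset.sum_congr rfl (g := fun _ => ZMod.stdAddChar ((x : ZMod p) * a)), Finset.sum_const,
      nsmul_eq_mul]
    · congr 1
      have h2 := quadraticChar_card_sqrts (ringChar_zmod_ne_two hp) a
      have h3 : ({r : ZMod p | r ^ 2 = a} : Set (ZMod p)).toFinset =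
          Finset.univ.filter fun r : ZMod p => r ^ 2 = a := by ext; simp
      rw [h3] at h2
      have h4 : ((Finset.univ.filter fun r : ZMod p => r ^ 2 = a).card : ℂ) =
          ((quadraticChar (ZMod p) a + 1 : ℤ) : ℂ) := by
        rw [← h2]; simp
      rw [h4]
      push_cast
      rfl
    · intro r hr
      rw [(Finset.mem_filter.mp hr).2]
  have h5 : ∑ a : ZMod p, ZMod.stdAddChar ((x : ZMod p) * a) = 0 := by
    have := AddChar.sum_mulShift (x : ZMod p) (ZMod.isPrimitive_stdAddChar p)
    simp only [hx, if_false] at this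
    rw [Nat.cast_zero] at this
    rw [← this]
    exact Finset.sum_congr rfl fun a _ => by rw [mul_comm]
  have h6 := gaussSum_mulShift (complexQuadraticChar p) ZMod.stdAddChar (Units.mk0 _ hx)
  have h7 : (legendreSym p x : ℂ) * legendreSym p x = 1 := by
    have := legendreSym.sq_one p hx
    rw [pow_two] at this
    exact_mod_cast this
  have h8 : gaussSum (complexQuadraticChar p) (ZMod.stdAddChar.mulShift (Units.mk0 _ hx : (ZMod p)ˣ)) =
      ∑ a : ZMod p, complexQuadraticChar p a * ZMod.stdAddChar ((x : ZMod p) * a) := by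
    simp [gaussSum, AddChar.mulShift_apply]
  rw [h8, Units.val_mk0, complexQuadraticChar_intCast] at h6
  rw [h1]
  simp only [add_mul, one_mul]
  rw [Finset.sum_add_distrib, h5, add_zero, ← h6, ← mul_assoc, h7, one_mul]

lemma gaussSum_complexQuadraticChar_sq (hp : p ≠ 2) :
    gaussSum (complexQuadraticChar p) ZMod.stdAddChar ^ 2 = legendreSym p (-1) * p := by
  have h1 : complexQuadraticChar p ≠ 1 := by
    intro h
    obtain ⟨a, ha⟩ := quadraticChar_exists_neg_one (ringChar_zmod_ne_two hp)
    have h2 : complexQuadraticChar p a = -1 := by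
      show ((quadraticChar (ZMod p) a : ℤ) : ℂ) = -1
      rw [ha]; simp
    have ha0 : a ≠ 0 := by
      rintro rfl
      simp at ha
    rw [h, MulChar.one_apply (isUnit_iff_ne_zero.mpr ha0)] at h2
    norm_num at h2
  have h2 : (complexQuadraticChar p).IsQuadratic :=
    (quadraticChar_isQuadratic (ZMod p)).comp _
  rw [gaussSum_sq h1 h2 (ZMod.isPrimitive_stdAddChar p), ZMod.card]
  congr 1
  have := complexQuadraticChar_intCast p (-1)
  rwa [Int.cast_neg, Int.cast_one] at this

lemma sum_fin_natCast_zmod (f : ZMod p → ℂ) : ∑ r : Fin p, f ((r : ℕ) : ZMod p) = ∑ r, f r := by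
  refine Finset.sum_bij' (fun r _ => ((r : ℕ) : ZMod p))
    (fun r _ => ⟨r.val, r.val_lt⟩) (by simp) (by simp) ?_ ?_ (by simp)
  · intro r _
    apply Fin.ext
    exact ZMod.val_cast_of_lt r.2
  · intro r _
    simp

lemma sum_exp_even (hp : p ≠ 2) {x : ℤ} (hx : (x : ZMod p) ≠ 0) :
    ∑ r : Fin p, Complex.exp (π * Complex.I * ((r : ℕ) + (0 : ℝ)) ^ 2 * ((2 * x / p : ℝ) : ℂ)) =
      legendreSym p x * gaussSum (complexQuadraticChar p) ZMod.stdAddChar := by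
  rw [← sum_stdAddChar_mul_sq hp hx, ← sum_fin_natCast_zmod]
  refine Finset.sum_congr rfl fun r _ => ?_
  have h := ZMod.stdAddChar_coe (N := p) (x * (r : ℕ) ^ 2)
  push_cast at h ⊢
  rw [h]
  congr 1
  ring

/-- The phase is x(2r+1)²/(8p). Replacing 1/8 by an inverse k of 8 modulo p costs the factor
exp(πixp/4), independent of r; then r ↦ 2r + 1 permutes the residues, and (k/p) = (8/p) = (2/p). -/
lemma sum_exp_odd (hp : p ≠ 2) {x : ℤ} (hx : (x : ZMod p) ≠ 0) :
    ∑ r : Fin p, Complex.exp (π * Complex.I * ((r : ℕ) + ((1 / 2 : ℝ) : ℂ)) ^ 2 *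
        ((x / p : ℝ) : ℂ)) =
      Complex.exp (π * Complex.I * x * p / 4) *
        (legendreSym p (2 * x) * gaussSum (complexQuadraticChar p) ZMod.stdAddChar) := by
  have hpp : p.Prime := Fact.out
  have hp0 : (p : ℂ) ≠ 0 := by exact_mod_cast hpp.ne_zero
  have hodd : Odd p := hpp.odd_of_ne_two hp
  have h2 : ((2 : ℤ) : ZMod p) ≠ 0 := by
    rw [Ne, ZMod.intCast_zmod_eq_zero_iff_dvd]
    intro h
    have : p ∣ 2 := by exact_mod_cast h
    exact hp ((Nat.prime_dvd_prime_iff_eq hpp Nat.prime_two).mp this)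
  obtain ⟨k, l, hkl⟩ : ∃ k l : ℤ, 8 * k = 1 + p * l := by
    have hc : IsCoprime (8 : ℤ) p := by
      have : Nat.Coprime 8 p := Nat.Coprime.pow_left 3 ((Nat.coprime_two_left).mpr hodd)
      exact_mod_cast Nat.isCoprime_iff_coprime.mpr this
    obtain ⟨u, t, hut⟩ := hc
    exact ⟨u, -t, by linarith⟩
  have h8k : (8 : ZMod p) * k = 1 := by
    have := congrArg (Int.cast : ℤ → ZMod p) hkl
    push_cast at this
    simpa using this
  have h2' : (2 : ZMod p) ≠ 0 := by simpa using h2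
  have hk0 : (k : ZMod p) ≠ 0 := by
    intro h
    rw [h, mul_zero] at h8k
    exact zero_ne_one h8k
  have hxk : ((x * k : ℤ) : ZMod p) ≠ 0 := by
    push_cast
    exact mul_ne_zero hx hk0
  have hleg : legendreSym p (x * k) = legendreSym p (2 * x) := by
    have e1 : legendreSym p (8 * k) = 1 := by
      rw [legendreSym.mod, hkl, Int.add_mul_emod_self_left, ← legendreSym.mod, legendreSym.at_one]
    have e2 : legendreSym p 8 = legendreSym p 2 := by
      have : (8 : ℤ) = 2 ^ 2 * 2 := by norm_num
      rw [this, legendreSym.mul, legendreSym.sq_one' p h2, one_mul]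
    rw [legendreSym.mul, e2] at e1
    have e3 := legendreSym.sq_one p h2
    rw [legendreSym.mul, legendreSym.mul]
    linear_combination (legendreSym p x * legendreSym p 2) * e1 -
      (legendreSym p x * legendreSym p k) * e3
  rw [← hleg, ← sum_stdAddChar_mul_sq hp hxk, Finset.mul_sum]
  have hbij : ∑ r : ZMod p, Complex.exp (π * Complex.I * x * p / 4) *
      ZMod.stdAddChar (((x * k : ℤ) : ZMod p) * r ^ 2) =
      ∑ r : ZMod p, Complex.exp (π * Complex.I * x * p / 4) *
        ZMod.stdAddChar (((x * k : ℤ) : ZMod p) * (2 * r + 1) ^ 2) := by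
    refine (Equiv.sum_comp ((Equiv.mulLeft₀ (2 : ZMod p) h2').trans (Equiv.addRight 1)) _).symm.trans ?_
    rfl
  rw [hbij, ← sum_fin_natCast_zmod]
  refine Finset.sum_congr rfl fun r _ => ?_
  have h := ZMod.stdAddChar_coe (N := p) (x * k * (2 * (r : ℕ) + 1) ^ 2)
  push_cast at h ⊢
  rw [h, ← Complex.exp_add, Complex.exp_eq_exp_iff_exists_int]
  -- Odd squares are 1 modulo 8, and 8k = 1 + pl gives l ≡ -p modulo 8. The two phases then differ
  -- by the integer xt.
  obtain ⟨t, ht⟩ : (8 : ℤ) ∣ (2 * (r : ℕ) + 1) ^ 2 * l + p := by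
    have e1 : (8 : ℤ) ∣ (2 * (r : ℕ) + 1) ^ 2 - 1 := Int.eight_dvd_sq_sub_one_of_odd ⟨(r : ℕ), rfl⟩
    have e2 : (8 : ℤ) ∣ (p : ℤ) ^ 2 - 1 := Int.eight_dvd_sq_sub_one_of_odd (by exact_mod_cast hodd)
    have e3 : ((2 * (r : ℕ) + 1) ^ 2 * l + p : ℤ) =
        l * ((2 * (r : ℕ) + 1) ^ 2 - 1) + 8 * (k * p) - l * (p ^ 2 - 1) := by
      linear_combination (-(p : ℤ)) * hkl
    rw [e3]
    exact dvd_sub (dvd_add (e1.mul_left _) (dvd_mul_right _ _)) (e2.mul_left _)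
  refine ⟨-(x * t), ?_⟩
  have hkl' : (8 * k : ℂ) = 1 + p * l := by exact_mod_cast hkl
  have ht' : ((2 * (r : ℕ) + 1) ^ 2 * l + p : ℂ) = 8 * t := by exact_mod_cast ht
  have hk' : (k : ℂ) = (1 + p * l) / 8 := by rw [← hkl']; ring
  have ht'' : (t : ℂ) = ((2 * (r : ℕ) + 1) ^ 2 * l + p) / 8 := by rw [ht']; ring
  push_cast
  rw [hk', ht'']
  field_simp
  ring

end GaussSums

lemma exp_period_even (x : ℤ) {d : ℕ} (hd : 0 < d) (n k : ℤ) :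
    Complex.exp (π * Complex.I * (n + d * k + (0 : ℝ)) ^ 2 * ((2 * x / d : ℝ) : ℂ)) =
      Complex.exp (π * Complex.I * (n + (0 : ℝ)) ^ 2 * ((2 * x / d : ℝ) : ℂ)) := by
  have hd0 : (d : ℂ) ≠ 0 := by exact_mod_cast hd.ne'
  rw [Complex.exp_eq_exp_iff_exists_int]
  refine ⟨(2 * n * k + d * k ^ 2) * x, ?_⟩
  push_cast
  field_simp
  ring

/-- The exponents differ by πi·x·k(2n + 1 + dk), where k(2n + 1 + dk) is even because d is odd. -/
lemma exp_period_odd (x : ℤ) {d : ℕ} (hd : Odd d) (n k : ℤ) :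
    Complex.exp (π * Complex.I * (n + d * k + ((1 / 2 : ℝ) : ℂ)) ^ 2 * ((x / d : ℝ) : ℂ)) =
      Complex.exp (π * Complex.I * (n + ((1 / 2 : ℝ) : ℂ)) ^ 2 * ((x / d : ℝ) : ℂ)) := by
  have hd0 : (d : ℂ) ≠ 0 := by exact_mod_cast hd.pos.ne'
  obtain ⟨t, ht⟩ : Even (k * (2 * n + 1 + d * k)) := by
    have : Odd (d : ℤ) := by exact_mod_cast hd
    rcases Int.even_or_odd k with hk | hk
    · exact hk.mul_right _
    · exact (Odd.add_odd ⟨n, rfl⟩ (this.mul hk)).mul_left _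
  have ht' : (t : ℂ) = k * (2 * n + 1 + d * k) / 2 := by
    have : (k * (2 * n + 1 + d * k) : ℂ) = t + t := by exact_mod_cast ht
    rw [this]; ring
  rw [Complex.exp_eq_exp_iff_exists_int]
  refine ⟨t * x, ?_⟩
  push_cast
  rw [ht']
  field_simp
  ring

/-! ### Transformation and growth of the individual factors -/

lemma det_expand (γ : SL(2, ℤ)) : γ 0 0 * γ 1 1 - γ 0 1 * γ 1 0 = 1 := by
  rw [← Matrix.det_fin_two]; exact γ.det_coe

/-- The class (1, 1) must be preserved at the argument 2mτ; this needs γ₁₀/(2m) even, whence the 4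
in the level. -/
lemma shiftedTheta_zero_pow_eight_smul {γ : SL(2, ℤ)} {m : ℕ} (hm : 0 < m)
    (h : ((4 * m : ℕ) : ℤ) ∣ γ 1 0) (τ : ℍ) :
    shiftedTheta 0 ((2 * m : ℕ) * ((γ • τ : ℍ) : ℂ)) ^ 8 =
      denom γ τ ^ 4 * shiftedTheta 0 ((2 * m : ℕ) * (τ : ℂ)) ^ 8 := by
  obtain ⟨t, ht⟩ := h
  have hm2 : 0 < 2 * m := by positivity
  have hl : γ 1 0 = 2 * t * (2 * m : ℕ) := by rw [ht]; push_cast; ring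
  have key := thetaEighth_natScale_smul γ hm2 (c := 1) (d := 1) (by simp) hl τ
  have hdet := det_expand γ
  have hodd : Odd (γ 0 0 * γ 1 1) := by
    have : γ 0 0 * γ 1 1 = 2 * (γ 0 1 * (t * (2 * m))) + 1 := by
      rw [hl] at hdet; push_cast at hdet; linear_combination hdet
    rw [this]; exact odd_two_mul_add_one _
  obtain ⟨h1, h2⟩ := Int.odd_mul.mp hodd
  have e1 : ¬ Even (1 * γ 0 0 + 1 * (2 * t)) := by grind
  have e2 : ¬ Even (1 * ((2 * m : ℕ) * γ 0 1) + 1 * γ 1 1) := by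
    push_cast; grind
  simp only [thetaEighth, e1, e2, if_false, coe_natScale] at key
  simpa using key

/-- Here the class is (0, 1), and only the parity of γ₁₀/m matters; this is the 2 in the level. -/
lemma shiftedTheta_half_pow_eight_smul {γ : SL(2, ℤ)} {m : ℕ} (hm : 0 < m)
    (h : ((2 * m : ℕ) : ℤ) ∣ γ 1 0) (τ : ℍ) :
    shiftedTheta (1 / 2) (m * ((γ • τ : ℍ) : ℂ)) ^ 8 =
      denom γ τ ^ 4 * shiftedTheta (1 / 2) (m * (τ : ℂ)) ^ 8 := by
  obtain ⟨t, ht⟩ := h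
  have hl : γ 1 0 = 2 * t * m := by rw [ht]; push_cast; ring
  have key := thetaEighth_natScale_smul γ hm (c := 0) (d := 1) (by simp) hl τ
  simpa [thetaEighth] using key

lemma exists_norm_shiftedTheta_zero_pow_le (γ : SL(2, ℤ)) {m : ℕ} (hm : 0 < m) :
    ∃ C Y : ℝ, ∀ τ : ℍ, Y ≤ τ.im →
      ‖shiftedTheta 0 (m * ((γ • τ : ℍ) : ℂ))‖ ^ 8 ≤ C * ‖denom γ τ‖ ^ 4 := by
  simpa [thetaEighth] using exists_norm_thetaEighth_smul_le γ hm (c := 1) (d := 1) (by simp)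

lemma exists_norm_shiftedTheta_half_pow_le (γ : SL(2, ℤ)) {m : ℕ} (hm : 0 < m) :
    ∃ C Y : ℝ, ∀ τ : ℍ, Y ≤ τ.im →
      ‖shiftedTheta (1 / 2) (m * ((γ • τ : ℍ) : ℂ))‖ ^ 8 ≤ C * ‖denom γ τ‖ ^ 4 := by
  simpa [thetaEighth] using exists_norm_thetaEighth_smul_le γ hm (c := 0) (d := 1) (by simp)

/-! ### The product: holomorphy, transformation up to a constant, growth at cusps -/

variable {v k : ℕ} {b : Fin v → ℕ} {c : Fin k → ℕ}

lemma four_mul_dvd_level (i : Fin v) : 4 * b i ∣ level b c :=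
  (mul_dvd_mul_left 4 (Finset.dvd_lcm (Finset.mem_univ i))).trans (Nat.dvd_lcm_left _ _)

lemma two_mul_dvd_level (j : Fin k) : 2 * c j ∣ level b c :=
  (mul_dvd_mul_left 2 (Finset.dvd_lcm (Finset.mem_univ j))).trans (Nat.dvd_lcm_right _ _)

lemma four_dvd_level : 4 ∣ level b c :=
  (dvd_mul_right 4 _).trans (Nat.dvd_lcm_left _ _)

lemma level_pos (hb : ∀ i, 0 < b i) (hc : ∀ j, 0 < c j) : 0 < level b c := by
  have h1 : Finset.univ.lcm b ≠ 0 := by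
    rw [Ne, Finset.lcm_eq_zero_iff]
    rintro ⟨i, -, hi⟩
    exact (hb i).ne' hi
  have h2 : Finset.univ.lcm c ≠ 0 := by
    rw [Ne, Finset.lcm_eq_zero_iff]
    rintro ⟨i, -, hi⟩
    exact (hc i).ne' hi
  exact Nat.lcm_pos (by positivity) (by positivity)

lemma mem_Gamma0_iff_dvd {N : ℕ} {γ : SL(2, ℤ)} :
    γ ∈ CongruenceSubgroup.Gamma0 N ↔ (N : ℤ) ∣ γ 1 0 := by
  rw [CongruenceSubgroup.Gamma0_mem, ZMod.intCast_zmod_eq_zero_iff_dvd]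

lemma mdifferentiable_mixedSeries (hb : ∀ i, 0 < b i) (hc : ∀ j, 0 < c j) :
    MDiff (mixedSeries b c) := by
  rw [mdifferentiable_iff]
  have h : ∀ z ∈ {z : ℂ | 0 < z.im}, (mixedSeries b c ∘ ofComplex) z =
      (∏ i, shiftedTheta 0 ((2 * b i : ℕ) * z)) * ∏ j, (shiftedTheta (1 / 2) ((c j : ℂ) * z) / 2) := by
    intro z hz
    rw [Function.comp_apply, mixedSeries_eq b c hb hc, ofComplex_apply_of_im_pos hz]
  refine DifferentiableOn.congr ?_ h
  intro z hz
  have him : ∀ n : ℕ, 0 < n → 0 < ((n : ℂ) * z).im := fun n hn =>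
    natCast_mul_im_pos hn ⟨z, hz⟩
  have hd : ∀ (a : ℝ) (n : ℕ), 0 < n →
      DifferentiableAt ℂ (fun z : ℂ => shiftedTheta a ((n : ℂ) * z)) z := by
    intro a n hn
    exact (differentiableAt_shiftedTheta a (him n hn)).comp z (by fun_prop)
  refine DifferentiableAt.differentiableWithinAt ?_
  refine DifferentiableAt.mul ?_ ?_
  · exact DifferentiableAt.fun_finsetProd fun i _ => hd 0 _ (by have := hb i; positivity)
  · exact DifferentiableAt.fun_finsetProd fun j _ => (hd _ _ (hc j)).div_const 2

lemma eventually_mixedSeries_ne_zero (hb : ∀ i, 0 < b i) (hc : ∀ j, 0 < c j) :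
    ∀ᶠ n in atTop, mixedSeries b c (cuspSeq n) ≠ 0 := by
  have h1 : ∀ᶠ n in atTop, ∀ i, shiftedTheta 0 ((2 * b i : ℕ) * cuspSeq n) ≠ 0 :=
    eventually_all.mpr fun i => eventually_shiftedTheta_ne_zero 0 (by have := hb i; positivity)
  have h2 : ∀ᶠ n in atTop, ∀ j, shiftedTheta (1 / 2) (c j * cuspSeq n) ≠ 0 :=
    eventually_all.mpr fun j => eventually_shiftedTheta_ne_zero _ (hc j)
  filter_upwards [h1, h2] with n h1 h2
  rw [mixedSeries_eq b c hb hc]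
  exact mul_ne_zero (Finset.prod_ne_zero_iff.mpr fun i _ => h1 i)
    (Finset.prod_ne_zero_iff.mpr fun j _ => div_ne_zero (h2 j) two_ne_zero)

lemma mixedSeries_ne_zero (hb : ∀ i, 0 < b i) (hc : ∀ j, 0 < c j) : mixedSeries b c ≠ 0 := by
  obtain ⟨n, hn⟩ := (eventually_mixedSeries_ne_zero hb hc).exists
  exact fun h => hn (congrFun h _)

lemma mixedSeries_slash_pow_eight (hvk : Even (v + k)) (hb : ∀ i, 0 < b i) (hc : ∀ j, 0 < c j)
    {γ : SL(2, ℤ)} (hγ : γ ∈ CongruenceSubgroup.Gamma0 (level b c)) (τ : ℍ) :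
    (mixedSeries b c ∣[(((v + k) / 2 : ℕ) : ℤ)] γ) τ ^ 8 = mixedSeries b c τ ^ 8 := by
  rw [mem_Gamma0_iff_dvd] at hγ
  have hn : denom γ τ ≠ 0 := denom_ne_zero _ _
  have h1 : mixedSeries b c (γ • τ) ^ 8 = denom γ τ ^ (4 * (v + k)) * mixedSeries b c τ ^ 8 := by
    rw [mixedSeries_eq b c hb hc, mixedSeries_eq b c hb hc, mul_pow, mul_pow, ← Finset.prod_pow,
      ← Finset.prod_pow, ← Finset.prod_pow, ← Finset.prod_pow]
    have e1 : ∀ i, shiftedTheta 0 ((2 * b i : ℕ) * ((γ • τ : ℍ) : ℂ)) ^ 8 =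
        denom γ τ ^ 4 * shiftedTheta 0 ((2 * b i : ℕ) * (τ : ℂ)) ^ 8 := fun i =>
      shiftedTheta_zero_pow_eight_smul (hb i)
        ((Int.natCast_dvd_natCast.mpr (four_mul_dvd_level i)).trans hγ) τ
    have e2 : ∀ j, (shiftedTheta (1 / 2) (c j * ((γ • τ : ℍ) : ℂ)) / 2) ^ 8 =
        denom γ τ ^ 4 * (shiftedTheta (1 / 2) (c j * (τ : ℂ)) / 2) ^ 8 := by
      intro j
      rw [div_pow, div_pow, shiftedTheta_half_pow_eight_smul (hc j)
        ((Int.natCast_dvd_natCast.mpr (two_mul_dvd_level j)).trans hγ) τ, mul_div_assoc]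
    simp only [e1, e2, Finset.prod_mul_distrib, Finset.prod_const, Finset.card_univ,
      Fintype.card_fin]
    ring
  rw [SL_slash_apply, mul_pow, h1]
  have h2 : (denom γ τ ^ (-(((v + k) / 2 : ℕ) : ℤ))) ^ 8 = (denom γ τ ^ (4 * (v + k)))⁻¹ := by
    rw [← zpow_natCast, ← zpow_mul, ← zpow_natCast, ← zpow_neg]
    congr 1
    obtain ⟨w, hw⟩ := hvk
    have : (v + k) / 2 = w := by omega
    rw [this, hw]
    push_cast
    ring
  rw [h2]
  have := pow_ne_zero (4 * (v + k)) hn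
  field_simp

/-- fⁿ - gⁿ is the product of the f - ζg over n-th roots of unity ζ, and a finite product of
holomorphic functions on ℍ vanishes only if some factor does. -/
lemma exists_eq_smul_of_pow_eq {f g : ℍ → ℂ} (hf : MDiff f) (hg : MDiff g) {n : ℕ} (hn : 0 < n)
    (h : ∀ τ, f τ ^ n = g τ ^ n) : ∃ ζ : ℂ, f = ζ • g := by
  have hprim := Complex.isPrimitiveRoot_exp n hn.ne'
  have h0 : ∏ ζ ∈ Polynomial.nthRootsFinset n (1 : ℂ), (f - ζ • g) = 0 := by
    ext τ
    rw [Finset.prod_apply]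
    have := hprim.pow_sub_pow_eq_prod_sub_mul (f τ) (g τ) hn
    rw [h τ, sub_self] at this
    simpa using this.symm
  obtain ⟨ζ, -, hζ⟩ := (UpperHalfPlane.prod_eq_zero_iff fun ζ _ => hf.sub (hg.const_smul ζ)).mp h0
  exact ⟨ζ, sub_eq_zero.mp hζ⟩

lemma exists_mixedSeries_slash_eq (hvk : Even (v + k)) (hb : ∀ i, 0 < b i) (hc : ∀ j, 0 < c j)
    {γ : SL(2, ℤ)} (hγ : γ ∈ CongruenceSubgroup.Gamma0 (level b c)) :
    ∃ ζ : ℂ, mixedSeries b c ∣[(((v + k) / 2 : ℕ) : ℤ)] γ = ζ • mixedSeries b c :=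
  exists_eq_smul_of_pow_eq ((mdifferentiable_mixedSeries hb hc).slash _ _)
    (mdifferentiable_mixedSeries hb hc) (by norm_num : 0 < 8)
    (mixedSeries_slash_pow_eight hvk hb hc hγ)

lemma isBoundedAtImInfty_mixedSeries_slash (hvk : Even (v + k)) (hb : ∀ i, 0 < b i)
    (hc : ∀ j, 0 < c j) (γ : SL(2, ℤ)) :
    IsBoundedAtImInfty (mixedSeries b c ∣[(((v + k) / 2 : ℕ) : ℤ)] γ) := by
  have hb2 : ∀ i, 0 < 2 * b i := fun i => by have := hb i; positivity
  choose C₀ Y₀ h₀ using fun i => exists_norm_shiftedTheta_zero_pow_le γ (hb2 i)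
  choose C₁ Y₁ h₁ using fun j => exists_norm_shiftedTheta_half_pow_le γ (hc j)
  have hlarge : ∀ Y : ℝ, ∀ᶠ τ : ℍ in atImInfty, Y ≤ τ.im := fun Y =>
    (atImInfty_mem _).mpr ⟨Y, fun _ h => h⟩
  rw [isBoundedAtImInfty_iff]
  suffices h : ∃ K : ℝ, ∀ᶠ τ : ℍ in atImInfty,
      ‖(mixedSeries b c ∣[(((v + k) / 2 : ℕ) : ℤ)] γ) τ‖ ^ 8 ≤ K by
    obtain ⟨K, hK⟩ := h
    obtain ⟨A, hA⟩ := (atImInfty_mem _).mp hK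
    -- Taking the maximum with 1 ensures K ≤ (max K 1)⁸, so the eighth root can be taken.
    refine ⟨max K 1, A, fun τ hτ => ?_⟩
    have h1 : ‖(mixedSeries b c ∣[(((v + k) / 2 : ℕ) : ℤ)] γ) τ‖ ^ 8 ≤ max K 1 ^ 8 :=
      (hA τ hτ).trans ((le_max_left K 1).trans (le_self_pow₀ (le_max_right K 1) (by norm_num)))
    exact le_of_pow_le_pow_left₀ (by norm_num) (by positivity) h1
  refine ⟨(∏ i, C₀ i) * ∏ j, (C₁ j / 2 ^ 8), ?_⟩
  filter_upwards [eventually_all.mpr fun i => hlarge (Y₀ i),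
    eventually_all.mpr fun j => hlarge (Y₁ j)] with τ t₀ t₁
  have hn : 0 < ‖denom γ τ‖ := norm_pos_iff.mpr (denom_ne_zero _ _)
  have key : ‖mixedSeries b c (γ • τ)‖ ^ 8 ≤
      ((∏ i, C₀ i) * ∏ j, (C₁ j / 2 ^ 8)) * ‖denom γ τ‖ ^ (4 * (v + k)) := by
    rw [mixedSeries_eq b c hb hc, norm_mul, norm_prod, norm_prod, mul_pow, ← Finset.prod_pow,
      ← Finset.prod_pow]
    have e1 : ∏ i, ‖shiftedTheta 0 ((2 * b i : ℕ) * ((γ • τ : ℍ) : ℂ))‖ ^ 8 ≤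
        ∏ i, (C₀ i * ‖denom γ τ‖ ^ 4) :=
      Finset.prod_le_prod (fun _ _ => by positivity) fun i _ => h₀ i τ (t₀ i)
    have e2 : ∏ j, ‖shiftedTheta (1 / 2) (c j * ((γ • τ : ℍ) : ℂ)) / 2‖ ^ 8 ≤
        ∏ j, (C₁ j / 2 ^ 8 * ‖denom γ τ‖ ^ 4) := by
      refine Finset.prod_le_prod (fun _ _ => by positivity) fun j _ => ?_
      rw [norm_div, div_pow, div_mul_eq_mul_div, Complex.norm_ofNat]
      gcongr
      exact h₁ j τ (t₁ j)
    refine (mul_le_mul e1 e2 (by positivity) ((by positivity : (0 : ℝ) ≤ _).trans e1)).trans ?_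
    simp only [Finset.prod_mul_distrib, Finset.prod_const, Finset.card_univ, Fintype.card_fin]
    apply le_of_eq
    ring
  rw [SL_slash_apply, norm_mul, mul_pow]
  have h2 : ‖denom γ τ ^ (-(((v + k) / 2 : ℕ) : ℤ))‖ ^ 8 = (‖denom γ τ‖ ^ (4 * (v + k)))⁻¹ := by
    rw [norm_zpow, ← zpow_natCast, ← zpow_mul, ← zpow_natCast, ← zpow_neg]
    congr 1
    obtain ⟨w, hw⟩ := hvk
    have : (v + k) / 2 = w := by omega
    rw [this, hw]
    push_cast
    ring
  rw [h2, ← div_eq_mul_inv, div_le_iff₀ (by positivity)]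
  exact key

/-! ### Translation by one and the residue of h modulo 8 -/

lemma theta_add_natCast (τ : ℂ) (m : ℕ) : theta (τ + m) = theta τ := by
  unfold theta
  refine tsum_congr fun n => ?_
  rw [Complex.exp_eq_exp_iff_exists_int]
  refine ⟨m * n ^ 2, ?_⟩
  push_cast
  ring

lemma Psi_add_natCast (τ : ℂ) (m : ℕ) : Psi (τ + m) = Psi τ := by
  unfold Psi
  refine tsum_congr fun n => ?_
  rw [Complex.exp_eq_exp_iff_exists_int]
  refine ⟨(m * (n * (n + 1) / 2) : ℕ), ?_⟩
  rw [Int.cast_natCast, Nat.cast_mul m]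
  ring

lemma mixedSeries_slash_T (w : ℤ) : mixedSeries b c ∣[w] ModularGroup.T =
    Complex.exp (2 * π * Complex.I * (((∑ j, c j : ℕ) : ℂ) / 8)) • mixedSeries b c := by
  ext τ
  have hT : ((ModularGroup.T • τ : ℍ) : ℂ) = τ + 1 := by
    rw [modular_T_smul]
    simp [add_comm]
  have hden : denom ModularGroup.T τ = 1 := by
    rw [ModularGroup.denom_apply]; simp [ModularGroup.T]
  rw [SL_slash_apply, hden, one_zpow, mul_one, Pi.smul_apply, smul_eq_mul, mixedSeries,
    mixedSeries, hT]
  simp only [mul_add, mul_one, theta_add_natCast, Psi_add_natCast, add_mul, Complex.exp_add]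
  ring

lemma exp_eq_one_iff_modEq (h : ℕ) :
    Complex.exp (2 * π * Complex.I * ((h : ℂ) / 8)) = 1 ↔ h ≡ 0 [MOD 8] := by
  rw [Complex.exp_eq_one_iff, Nat.modEq_zero_iff_dvd]
  constructor
  · rintro ⟨n, hn⟩
    have h1 : (h : ℂ) / 8 = n := by
      have := Complex.two_pi_I_ne_zero
      rw [mul_comm (n : ℂ)] at hn
      exact mul_left_cancel₀ this hn
    rw [div_eq_iff (by norm_num)] at h1
    have h2 : (h : ℤ) = n * 8 := by exact_mod_cast h1
    omega
  · rintro ⟨n, rfl⟩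
    refine ⟨n, ?_⟩
    push_cast
    ring

/-! ### The constant for a prime lower right entry -/

lemma legendreSym_prod (p : ℕ) [Fact p.Prime] {ι : Type*} (s : Finset ι) (f : ι → ℤ) :
    legendreSym p (∏ i ∈ s, f i) = ∏ i ∈ s, legendreSym p (f i) :=
  map_prod (legendreSym.hom p) f s

lemma legendreSym_pow (p : ℕ) [Fact p.Prime] (a : ℤ) (n : ℕ) :
    legendreSym p (a ^ n) = legendreSym p a ^ n :=
  map_pow (legendreSym.hom p) a n

/-- The transformation law for matrices whose lower right entry is a prime. -/
theorem mixedSeries_slash_of_prime (hvk : Even (v + k)) (hb : ∀ i, 0 < b i)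
    (hc : ∀ j, 0 < c j) (h8 : (∑ j, c j) ≡ 0 [MOD 8]) {γ : SL(2, ℤ)}
    (hγ : γ ∈ CongruenceSubgroup.Gamma0 (level b c)) {p : ℕ} [Fact p.Prime] (hp : γ 1 1 = p) :
    mixedSeries b c ∣[(((v + k) / 2 : ℕ) : ℤ)] γ =
      (legendreSym p (charNumerator b c) : ℂ) • mixedSeries b c := by
  obtain ⟨ζ, hζ⟩ := exists_mixedSeries_slash_eq hvk hb hc hγ
  rw [hζ]
  congr 1
  rw [mem_Gamma0_iff_dvd] at hγ
  have hpp : p.Prime := Fact.out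
  have hdet := det_expand γ
  rw [hp] at hdet
  have hndvd : ∀ x : ℤ, x ∣ γ 0 1 * γ 1 0 → ((x : ℤ) : ZMod p) ≠ 0 := by
    intro x hx h
    rw [ZMod.intCast_zmod_eq_zero_iff_dvd] at h
    have h1 : (p : ℤ) ∣ 1 := by
      rw [← hdet]
      exact dvd_sub (dvd_mul_left _ _) (h.trans hx)
    have h2 : p ∣ 1 := by exact_mod_cast h1
    exact hpp.one_lt.ne' (Nat.dvd_one.mp h2)
  have hdvd : ∀ n : ℕ, n ∣ level b c → (n : ℤ) ∣ γ 1 0 := fun n hn =>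
    (Int.natCast_dvd_natCast.mpr hn).trans hγ
  have h2' : ((2 : ℤ) : ZMod p) ≠ 0 := hndvd 2
    ((hdvd 2 ((by norm_num : 2 ∣ 4).trans four_dvd_level)).mul_left _)
  have hp2 : p ≠ 2 := by
    rintro rfl
    exact h2' (by rw [ZMod.intCast_zmod_eq_zero_iff_dvd]; norm_num)
  have hodd : Odd p := hpp.odd_of_ne_two hp2
  have hβ : ((γ 0 1 : ℤ) : ZMod p) ≠ 0 := hndvd _ (dvd_mul_right _ _)
  have hbβ : ∀ i, ((b i * γ 0 1 : ℤ) : ZMod p) ≠ 0 := fun i => hndvd _ (by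
    rw [mul_comm]
    exact mul_dvd_mul_left _ (hdvd _ ((dvd_mul_left _ 4).trans (four_mul_dvd_level i))))
  have hcβ : ∀ j, ((c j * γ 0 1 : ℤ) : ZMod p) ≠ 0 := fun j => hndvd _ (by
    rw [mul_comm]
    exact mul_dvd_mul_left _ (hdvd _ ((dvd_mul_left _ 2).trans (two_mul_dvd_level j))))
  set g : ℂ := gaussSum (complexQuadraticChar p) ZMod.stdAddChar with hg
  set L : ℤ → ℂ := fun x => (legendreSym p x : ℂ) with hL
  have hLmul : ∀ x y, L (x * y) = L x * L y := by
    intro x y; simp only [hL]; rw [legendreSym.mul]; push_cast; rfl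
  have hLsq : ∀ x : ℤ, (x : ZMod p) ≠ 0 → L x ^ 2 = 1 := by
    intro x hx
    have := legendreSym.sq_one p hx
    simp only [hL]
    exact_mod_cast this
  have lim0 : ∀ i, Tendsto (fun n => shiftedTheta 0 ((2 * b i : ℕ) * ((γ • cuspSeq n : ℍ) : ℂ)) /
      shiftedTheta 0 ((2 * b i : ℕ) * cuspSeq n)) atTop (𝓝 (L (b i * γ 0 1) * g)) := by
    intro i
    have e : (((2 * b i : ℕ) : ℝ) * γ 0 1 / p : ℝ) = 2 * ((b i * γ 0 1 : ℤ) : ℝ) / p := by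
      push_cast; ring
    have := tendsto_shiftedTheta_smul_div 0 (m := 2 * b i) (by have := hb i; positivity) hpp.pos γ hp
      (by rw [e]; exact exp_period_even _ hpp.pos)
    rw [e, sum_exp_even hp2 (hbβ i)] at this
    exact this
  have lim1 : ∀ j, Tendsto (fun n => shiftedTheta (1 / 2) (c j * ((γ • cuspSeq n : ℍ) : ℂ)) /
      shiftedTheta (1 / 2) (c j * cuspSeq n)) atTop
      (𝓝 (Complex.exp (π * Complex.I * (c j * γ 0 1 : ℤ) * p / 4) *
        (L (2 * (c j * γ 0 1)) * g))) := by
    intro j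
    have e : ((c j : ℝ) * γ 0 1 / p : ℝ) = ((c j * γ 0 1 : ℤ) : ℝ) / p := by
      push_cast; ring
    have := tendsto_shiftedTheta_smul_div (1 / 2) (m := c j) (hc j) hpp.pos γ hp
      (by rw [e]; exact exp_period_odd _ hodd)
    rw [e, sum_exp_odd hp2 (hcβ j)] at this
    exact this
  have hlim := (tendsto_finsetProd (Finset.univ : Finset (Fin v)) fun i _ => lim0 i).mul
    (tendsto_finsetProd (Finset.univ : Finset (Fin k)) fun j _ => lim1 j)
  have hden : Tendsto (fun n => ζ * denom γ (cuspSeq n) ^ ((v + k) / 2)) atTop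
      (𝓝 (ζ * (p : ℂ) ^ ((v + k) / 2))) := by
    refine Tendsto.const_mul _ (Tendsto.pow ?_ _)
    have := (tendsto_cuspSeq.const_mul (γ 1 0 : ℂ)).add_const (p : ℂ)
    rw [mul_zero, zero_add] at this
    refine this.congr fun n => ?_
    rw [ModularGroup.denom_apply, hp, Int.cast_natCast]
  -- The two sides have the limits ζp^w and a product of Gauss sums; uniqueness of limits determines
  -- ζ.
  have hratio : ∀ᶠ n in atTop, ζ * denom γ (cuspSeq n) ^ ((v + k) / 2) =
      (∏ i, shiftedTheta 0 ((2 * b i : ℕ) * ((γ • cuspSeq n : ℍ) : ℂ)) /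
        shiftedTheta 0 ((2 * b i : ℕ) * cuspSeq n)) *
      ∏ j, shiftedTheta (1 / 2) (c j * ((γ • cuspSeq n : ℍ) : ℂ)) /
        shiftedTheta (1 / 2) (c j * cuspSeq n) := by
    filter_upwards [eventually_mixedSeries_ne_zero hb hc] with n hn
    have e1 := congrFun hζ (cuspSeq n)
    have hd : denom γ (cuspSeq n) ≠ 0 := denom_ne_zero _ _
    rw [SL_slash_apply, zpow_neg, zpow_natCast, ← div_eq_mul_inv,
      div_eq_iff (pow_ne_zero _ hd), Pi.smul_apply, smul_eq_mul] at e1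
    have e2 : ζ * denom γ (cuspSeq n) ^ ((v + k) / 2) =
        mixedSeries b c (γ • cuspSeq n) / mixedSeries b c (cuspSeq n) := by
      rw [e1, eq_div_iff hn]; ring
    rw [e2, mixedSeries_eq b c hb hc, mixedSeries_eq b c hb hc, mul_div_mul_comm,
      ← Finset.prod_div_distrib, ← Finset.prod_div_distrib]
    congr 1
    refine Finset.prod_congr rfl fun j _ => ?_
    rw [div_div_div_cancel_right₀ two_ne_zero]
  have heq := tendsto_nhds_unique (hden.congr' hratio) hlim
  obtain ⟨w, hw⟩ := hvk
  have hw' : (v + k) / 2 = w := by omega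
  rw [hw'] at heq
  have hg2 : g ^ 2 = L (-1) * p := gaussSum_complexQuadraticChar_sq hp2
  -- The product is the power e^{2πih/8} to the exponent γ₀₁p; the hypothesis 8 ∣ h enters here.
  have hexp : ∏ j, Complex.exp (π * Complex.I * (c j * γ 0 1 : ℤ) * p / 4) = 1 := by
    rw [← Complex.exp_sum]
    rw [← (exp_eq_one_iff_modEq _)] at h8
    have e3 : ∑ j, (π * Complex.I * (c j * γ 0 1 : ℤ) * p / 4 : ℂ) =
        ((γ 0 1 * p : ℤ) : ℂ) * (2 * π * Complex.I * (((∑ j, c j : ℕ) : ℂ) / 8)) := by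
      push_cast
      rw [Finset.sum_div, Finset.mul_sum, Finset.mul_sum]
      refine Finset.sum_congr rfl fun j _ => ?_
      ring
    rw [e3, Complex.exp_int_mul, h8, one_zpow]
  have hp0 : (p : ℂ) ≠ 0 := by exact_mod_cast hpp.ne_zero
  have hLprod : ∀ {ι : Type} (s : Finset ι) (f : ι → ℤ), L (∏ i ∈ s, f i) = ∏ i ∈ s, L (f i) := by
    intro ι s f; simp only [hL]; rw [legendreSym_prod]; push_cast; rfl
  have hnum : L (charNumerator b c) = L (-1) ^ w * L 2 ^ k * (∏ i, L (b i)) * ∏ j, L (c j) := by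
    -- Each Ψ-factor contributes (2/p), so only the parity of k, equal to that of v, matters: this
    -- explains 4 versus 8.
    have e4 : L (if Even v then 4 else 8) = L 2 ^ k := by
      have h22 := hLsq 2 h2'
      split_ifs with hev
      · obtain ⟨s, hs⟩ : Even k := by rw [← Nat.even_add.mp ⟨w, hw⟩]; exact hev
        rw [hs, ← two_mul, pow_mul, h22, one_pow, show (4 : ℤ) = 2 * 2 by norm_num, hLmul, ← pow_two,
          h22]
      · obtain ⟨s, hs⟩ : Odd k := by
          rw [← Nat.not_even_iff_odd, ← Nat.even_add.mp ⟨w, hw⟩]; exact hev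
        rw [hs, pow_succ, pow_mul, h22, one_pow, show (8 : ℤ) = 2 * 2 * 2 by norm_num, hLmul, hLmul,
          ← pow_two, h22]
    have e5 : L ((-1) ^ w) = L (-1) ^ w := by
      simp only [hL]; rw [legendreSym_pow]; push_cast; rfl
    rw [charNumerator, hw', hLmul, hLmul, hLmul, e4, e5, hLprod, hLprod]
  show ζ = L (charNumerator b c)
  rw [hnum]
  refine mul_right_cancel₀ (pow_ne_zero w hp0) (heq.trans ?_)
  simp only [hLmul, Finset.prod_mul_distrib, hexp, Finset.prod_const, Finset.card_univ,
    Fintype.card_fin]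
  have e6 : L (γ 0 1) ^ v * L (γ 0 1) ^ k = 1 := by
    rw [← pow_add, hw, ← two_mul, pow_mul, hLsq _ hβ, one_pow]
  have e7 : g ^ v * g ^ k = L (-1) ^ w * (p : ℂ) ^ w := by
    rw [← pow_add, hw, ← two_mul, pow_mul, hg2, mul_pow]
  linear_combination (L 2 ^ k * (∏ i, L (b i)) * (∏ j, L (c j)) * g ^ v * g ^ k) * e6 +
    (L 2 ^ k * (∏ i, L (b i)) * (∏ j, L (c j))) * e7

/-! ### From primes to arbitrary lower right entries -/

lemma kroneckerSymbol_natCast (a : ℤ) {d : ℕ} (hd : Odd d) :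
    kroneckerSymbol a d = jacobiSym a d := by
  have h0 : d ≠ 0 := hd.pos.ne'
  have h1 : padicValNat 2 d = 0 :=
    padicValNat.eq_zero_of_not_dvd (by simpa [← even_iff_two_dvd] using hd)
  have h2 : ¬ (a < 0 ∧ (d : ℤ) < 0) := by omega
  simp [kroneckerSymbol, h0, h1, h2]

lemma kroneckerSymbol_neg_natCast (a : ℤ) {d : ℕ} (hd : Odd d) :
    kroneckerSymbol a (-d) = (if a < 0 then -1 else 1) * jacobiSym a d := by
  have h0 : d ≠ 0 := hd.pos.ne'
  have h1 : padicValNat 2 d = 0 :=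
    padicValNat.eq_zero_of_not_dvd (by simpa [← even_iff_two_dvd] using hd)
  have h2 : 0 < d := hd.pos
  simp [kroneckerSymbol, h0, h1, h2]

lemma jacobiSym_congr_right {a : ℤ} {m n : ℕ} (hm : Odd m) (hn : Odd n)
    (h : m ≡ n [MOD 4 * a.natAbs]) : jacobiSym a m = jacobiSym a n := by
  rw [jacobiSym.mod_right a hm, jacobiSym.mod_right a hn, h]

lemma slash_neg_eq (f : ℍ → ℂ) (w : ℕ) (γ : SL(2, ℤ)) :
    f ∣[(w : ℤ)] (-γ) = (-1 : ℂ) ^ w • (f ∣[(w : ℤ)] γ) := by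
  ext τ
  have hd : denom (-γ : SL(2, ℤ)) τ = -denom γ τ := by
    rw [ModularGroup.denom_apply, ModularGroup.denom_apply]
    simp
    ring
  rw [Pi.smul_apply, SL_slash_apply, SL_slash_apply, hd, ModularGroup.SL_neg_smul, smul_eq_mul,
    neg_eq_neg_one_mul (denom _ _), mul_zpow, zpow_neg, zpow_natCast, ← inv_pow, inv_neg_one]
  ring

lemma slash_zpow_eq {f : ℍ → ℂ} {w : ℤ} {γ : SL(2, ℤ)} (h : f ∣[w] γ = f) (n : ℤ) :
    f ∣[w] (γ ^ n) = f := by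
  have hinv : f ∣[w] γ⁻¹ = f := by
    conv_lhs => rw [← h]
    rw [← SlashAction.slash_mul, mul_inv_cancel, SlashAction.slash_one]
  induction n with
  | zero => simp
  | succ n ih => rw [zpow_add_one, SlashAction.slash_mul, ih, h]
  | pred n ih => rw [zpow_sub_one, SlashAction.slash_mul, ih, hinv]

/-- The Kronecker symbol's sign at -1 thus equals the factor (-1)^w by which -1 ∈ SL₂(ℤ) acts in
weight w. -/
lemma charNumerator_neg_iff (hb : ∀ i, 0 < b i) (hc : ∀ j, 0 < c j) :
    (if charNumerator b c < 0 then (-1 : ℤ) else 1) = (-1) ^ ((v + k) / 2) := by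
  have h1 : 0 < ∏ i, (b i : ℤ) := Finset.prod_pos fun i _ => by exact_mod_cast hb i
  have h2 : 0 < ∏ j, (c j : ℤ) := Finset.prod_pos fun j _ => by exact_mod_cast hc j
  have h3 : (0 : ℤ) < if Even v then 4 else 8 := by split_ifs <;> norm_num
  have h4 := mul_pos (mul_pos h3 h1) h2
  have h5 : charNumerator b c = (-1) ^ ((v + k) / 2) *
      ((if Even v then 4 else 8) * (∏ i, (b i : ℤ)) * ∏ j, (c j : ℤ)) := by
    rw [charNumerator]; ring
  rw [h5]
  rcases neg_one_pow_eq_or ℤ ((v + k) / 2) with h | h <;> rw [h]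
  · rw [if_neg (by linarith)]
  · rw [if_pos (by linarith)]

lemma isCoprime_charNumerator {d : ℤ} (h : IsCoprime d (level b c)) :
    IsCoprime d (charNumerator b c) := by
  have hdvd : ∀ n : ℕ, n ∣ level b c → IsCoprime d n := fun n hn =>
    h.of_isCoprime_of_dvd_right (Int.natCast_dvd_natCast.mpr hn)
  have h4 : IsCoprime d 4 := by exact_mod_cast hdvd 4 four_dvd_level
  have h2 : IsCoprime d 2 := h4.of_isCoprime_of_dvd_right (by norm_num)
  rw [charNumerator]
  refine IsCoprime.mul_right (IsCoprime.mul_right (IsCoprime.mul_right ?_ ?_) ?_) ?_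
  · exact IsCoprime.pow_right (isCoprime_one_right.neg_right)
  · split_ifs
    · exact h4
    · have := h4.mul_right h2
      norm_num at this
      exact this
  · exact IsCoprime.prod_right fun i _ => hdvd _ ((dvd_mul_left _ 4).trans (four_mul_dvd_level i))
  · exact IsCoprime.prod_right fun j _ => hdvd _ ((dvd_mul_left _ 2).trans (two_mul_dvd_level j))

lemma isCoprime_lower_row (γ : SL(2, ℤ)) : IsCoprime (γ 1 1) (γ 1 0) :=
  ⟨γ 0 0, -γ 0 1, by linear_combination det_expand γ⟩

lemma mixedSeries_slash_T_eq (h8 : (∑ j, c j) ≡ 0 [MOD 8]) (w : ℤ) :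
    mixedSeries b c ∣[w] ModularGroup.T = mixedSeries b c := by
  rw [mixedSeries_slash_T, (exp_eq_one_iff_modEq _).mpr h8, one_smul]

lemma mixedSeries_slash_of_pos (hvk : Even (v + k)) (hb : ∀ i, 0 < b i) (hc : ∀ j, 0 < c j)
    (h8 : (∑ j, c j) ≡ 0 [MOD 8]) {γ : SL(2, ℤ)} (hγ : γ ∈ CongruenceSubgroup.Gamma0 (level b c))
    (h0 : γ 1 0 ≠ 0) {d : ℕ} (hd : γ 1 1 = d) :
    mixedSeries b c ∣[(((v + k) / 2 : ℕ) : ℤ)] γ =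
      (jacobiSym (charNumerator b c) d : ℂ) • mixedSeries b c := by
  have hγ' := mem_Gamma0_iff_dvd.mp hγ
  set a := charNumerator b c with ha
  have hcop : IsCoprime (γ 1 1) (γ 1 0) := isCoprime_lower_row γ
  have h4 : (4 : ℤ) ∣ γ 1 0 := by
    have : ((4 : ℕ) : ℤ) ∣ level b c := Int.natCast_dvd_natCast.mpr four_dvd_level
    exact this.trans hγ'
  have ha1 : IsCoprime (γ 1 1) a := isCoprime_charNumerator (hcop.of_isCoprime_of_dvd_right hγ')
  have hodd_of : ∀ x : ℤ, IsCoprime x (γ 1 0) → Odd x := by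
    intro x hx
    have h2 : IsCoprime x 2 := hx.of_isCoprime_of_dvd_right ((by norm_num : (2 : ℤ) ∣ 4).trans h4)
    exact Int.isCoprime_two_right.mp h2
  have ha0 : a ≠ 0 := by
    rw [ha, charNumerator]
    refine mul_ne_zero (mul_ne_zero (mul_ne_zero (by simp) (by split_ifs <;> norm_num)) ?_) ?_
    · exact Finset.prod_ne_zero_iff.mpr fun i _ => by exact_mod_cast (hb i).ne'
    · exact Finset.prod_ne_zero_iff.mpr fun j _ => by exact_mod_cast (hc j).ne'
  have hcopq : IsCoprime (γ 1 1) ((4 * a.natAbs * (γ 1 0).natAbs : ℕ) : ℤ) := by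
    push_cast
    refine IsCoprime.mul_right (IsCoprime.mul_right (hcop.of_isCoprime_of_dvd_right h4) ?_) ?_
    · exact IsCoprime.abs_right ha1
    · exact IsCoprime.abs_right hcop
  -- Dirichlet's theorem. The factor γ₁₀ lets a power of T change the lower right entry to p; the
  -- factor 4|a| keeps the Jacobi symbol of a unchanged.
  obtain ⟨p, -, hpp, hpd⟩ := Nat.forall_exists_prime_gt_and_zmodEq 0
    (q := 4 * a.natAbs * (γ 1 0).natAbs) (by simp [ha0, h0]) hcopq
  have : Fact p.Prime := ⟨hpp⟩
  have hmod : (p : ℤ) ≡ d [ZMOD (4 * a.natAbs : ℕ)] := by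
    rw [← hd]
    refine Int.ModEq.of_mul_right ((γ 1 0).natAbs : ℤ) ?_
    exact_mod_cast hpd
  obtain ⟨n, hn⟩ : γ 1 0 ∣ p - γ 1 1 := by
    have h1 : ((4 * a.natAbs * (γ 1 0).natAbs : ℕ) : ℤ) ∣ p - γ 1 1 := hpd.symm.dvd
    refine dvd_trans ?_ h1
    push_cast
    exact Dvd.dvd.mul_left ((dvd_abs _ _).mpr dvd_rfl) _
  have hT := mixedSeries_slash_T_eq (b := b) h8 (((v + k) / 2 : ℕ) : ℤ)
  set δ : SL(2, ℤ) := γ * ModularGroup.T ^ n with hδ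
  have hδ10 : δ 1 0 = γ 1 0 := by
    simp [hδ, Matrix.SpecialLinearGroup.coe_mul, Matrix.mul_apply, Fin.sum_univ_two,
      ModularGroup.coe_T_zpow]
  have hδ11 : δ 1 1 = p := by
    have : δ 1 1 = γ 1 0 * n + γ 1 1 := by
      simp [hδ, Matrix.SpecialLinearGroup.coe_mul, Matrix.mul_apply, Fin.sum_univ_two,
        ModularGroup.coe_T_zpow]
    rw [this]; linarith
  have hδm : δ ∈ CongruenceSubgroup.Gamma0 (level b c) := by
    rw [mem_Gamma0_iff_dvd, hδ10]; exact hγ'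
  have key := mixedSeries_slash_of_prime hvk hb hc h8 hδm hδ11
  have hcopp : IsCoprime (p : ℤ) (γ 1 0) := by
    have := isCoprime_lower_row δ
    rwa [hδ10, hδ11] at this
  have hpodd : Odd p := by exact_mod_cast hodd_of _ hcopp
  have hdodd : Odd d := by exact_mod_cast hodd_of _ (hd ▸ hcop)
  rw [jacobiSym.legendreSym.to_jacobiSym,
    jacobiSym_congr_right hpodd hdodd (Int.natCast_modEq_iff.mp hmod)] at key
  have hγδ : γ = δ * ModularGroup.T ^ (-n) := by rw [hδ, mul_assoc, ← zpow_add]; simp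
  rw [hγδ, SlashAction.slash_mul, key, ModularForm.SL_smul_slash, slash_zpow_eq hT]

lemma mixedSeries_slash_of_ne_zero (hvk : Even (v + k)) (hb : ∀ i, 0 < b i) (hc : ∀ j, 0 < c j)
    (h8 : (∑ j, c j) ≡ 0 [MOD 8]) {γ : SL(2, ℤ)}
    (hγ : γ ∈ CongruenceSubgroup.Gamma0 (level b c)) (h0 : γ 1 0 ≠ 0) :
    mixedSeries b c ∣[(((v + k) / 2 : ℕ) : ℤ)] γ =
      (kroneckerSymbol (charNumerator b c) (γ 1 1) : ℂ) • mixedSeries b c := by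
  have hγ' := mem_Gamma0_iff_dvd.mp hγ
  have hodd : Odd (γ 1 1) := by
    have h4 : ((4 : ℕ) : ℤ) ∣ γ 1 0 :=
      (Int.natCast_dvd_natCast.mpr four_dvd_level).trans hγ'
    have h2 : IsCoprime (γ 1 1) 2 :=
      (isCoprime_lower_row γ).of_isCoprime_of_dvd_right ((by norm_num : (2 : ℤ) ∣ (4 : ℕ)).trans h4)
    exact Int.isCoprime_two_right.mp h2
  obtain ⟨d, hd | hd⟩ := Int.eq_nat_or_neg (γ 1 1)
  · have hdodd : Odd d := by rw [hd] at hodd; exact_mod_cast hodd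
    rw [mixedSeries_slash_of_pos hvk hb hc h8 hγ h0 hd, hd, kroneckerSymbol_natCast _ hdodd]
  · have hdodd : Odd d := by rw [hd] at hodd; exact_mod_cast (odd_neg.mp hodd)
    have hneg : -γ ∈ CongruenceSubgroup.Gamma0 (level b c) := by
      rw [mem_Gamma0_iff_dvd]; simpa using hγ'
    have key := mixedSeries_slash_of_pos hvk hb hc h8 hneg (by simpa using h0)
      (d := d) (by simp [hd])
    have h1 := slash_neg_eq (mixedSeries b c) ((v + k) / 2) (-γ)
    rw [neg_neg, key, smul_smul] at h1
    rw [h1, hd, kroneckerSymbol_neg_natCast _ hdodd, charNumerator_neg_iff hb hc]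
    push_cast
    rfl

/-- The transformation law of the mixed product under `Γ₀(M)`. -/
theorem mixedSeries_slash_eq (hvk : Even (v + k)) (hb : ∀ i, 0 < b i) (hc : ∀ j, 0 < c j)
    (h8 : (∑ j, c j) ≡ 0 [MOD 8]) {γ : SL(2, ℤ)} (hγ : γ ∈ CongruenceSubgroup.Gamma0 (level b c)) :
    mixedSeries b c ∣[(((v + k) / 2 : ℕ) : ℤ)] γ =
      (kroneckerSymbol (charNumerator b c) (γ 1 1) : ℂ) • mixedSeries b c := by
  have hγ' := mem_Gamma0_iff_dvd.mp hγ
  by_cases h0 : γ 1 0 = 0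
  · have hM : (level b c : ℤ) ≠ 0 := by exact_mod_cast (level_pos hb hc).ne'
    -- U fixes the product, and right multiplication by it makes the lower left entry nonzero
    -- without changing the lower right one.
    let U : SL(2, ℤ) := ⟨!![1, 0; (level b c : ℤ), 1], by simp [Matrix.det_fin_two_of]⟩
    have hU10 : U 1 0 = level b c := rfl
    have hU11 : U 1 1 = 1 := rfl
    have hUm : U ∈ CongruenceSubgroup.Gamma0 (level b c) := mem_Gamma0_iff_dvd.mpr dvd_rfl
    have hU : mixedSeries b c ∣[(((v + k) / 2 : ℕ) : ℤ)] U = mixedSeries b c := by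
      rw [mixedSeries_slash_of_ne_zero hvk hb hc h8 hUm hM, hU11]
      have := kroneckerSymbol_natCast (charNumerator b c) odd_one
      rw [Nat.cast_one] at this
      rw [this, jacobiSym.one_right, Int.cast_one, one_smul]
    have h10 : (γ * U) 1 0 = γ 1 1 * level b c := by
      rw [Matrix.SpecialLinearGroup.coe_mul, Matrix.mul_apply, Fin.sum_univ_two, h0, hU10]; ring
    have h11 : (γ * U) 1 1 = γ 1 1 := by
      rw [Matrix.SpecialLinearGroup.coe_mul, Matrix.mul_apply, Fin.sum_univ_two, h0, hU11]; ring
    have hd : γ 1 1 ≠ 0 := by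
      intro h
      have := det_expand γ
      rw [h, h0] at this
      simp at this
    have key := mixedSeries_slash_of_ne_zero hvk hb hc h8 (mul_mem hγ hUm)
      (by rw [h10]; exact mul_ne_zero hd hM)
    rw [h11] at key
    have h1 : γ = γ * U * U ^ (-1 : ℤ) := by simp
    rw [h1, SlashAction.slash_mul, key, ModularForm.SL_smul_slash, slash_zpow_eq hU, ← h1]
  · exact mixedSeries_slash_of_ne_zero hvk hb hc h8 hγ h0

/-! ### The Kronecker symbol as a Dirichlet character -/

/-- The two symbols are the multipliers of γ and γTⁿ on the same nonzero T-invariant function, hence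
equal. -/
lemma kroneckerSymbol_congr (hvk : Even (v + k)) (hb : ∀ i, 0 < b i) (hc : ∀ j, 0 < c j)
    (h8 : (∑ j, c j) ≡ 0 [MOD 8]) {d d' : ℤ} (hd : IsCoprime d (level b c))
    (h : (d : ZMod (level b c)) = d') :
    kroneckerSymbol (charNumerator b c) d = kroneckerSymbol (charNumerator b c) d' := by
  obtain ⟨n, hn⟩ := (ZMod.intCast_eq_intCast_iff_dvd_sub _ _ _).mp h
  obtain ⟨x, y, hxy⟩ := hd
  let γ : SL(2, ℤ) := ⟨!![x, -y; (level b c : ℤ), d], by rw [Matrix.det_fin_two_of]; linarith⟩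
  have hγ : γ ∈ CongruenceSubgroup.Gamma0 (level b c) := mem_Gamma0_iff_dvd.mpr dvd_rfl
  have h10 : (γ * ModularGroup.T ^ n) 1 0 = level b c := by
    have : γ 1 0 = level b c := rfl
    simp [Matrix.SpecialLinearGroup.coe_mul, Matrix.mul_apply, Fin.sum_univ_two,
      ModularGroup.coe_T_zpow, this]
  have h11 : (γ * ModularGroup.T ^ n) 1 1 = d' := by
    have e1 : γ 1 0 = level b c := rfl
    have e2 : γ 1 1 = d := rfl
    have : (γ * ModularGroup.T ^ n) 1 1 = level b c * n + d := by
      simp [Matrix.SpecialLinearGroup.coe_mul, Matrix.mul_apply, Fin.sum_univ_two,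
        ModularGroup.coe_T_zpow, e1, e2]
    rw [this]; linarith
  have k1 := mixedSeries_slash_eq hvk hb hc h8 hγ
  have k2 := mixedSeries_slash_eq hvk hb hc h8 (γ := γ * ModularGroup.T ^ n)
    (mem_Gamma0_iff_dvd.mpr (by rw [h10]))
  rw [SlashAction.slash_mul, k1, ModularForm.SL_smul_slash,
    slash_zpow_eq (mixedSeries_slash_T_eq h8 _), h11] at k2
  have := smul_left_injective ℂ (mixedSeries_ne_zero hb hc) k2
  exact_mod_cast this

/-- Multipliers of a nonzero function are multiplicative in γ, and the lower right entry of γγ' is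
dd' modulo the level. -/
lemma kroneckerSymbol_mul (hvk : Even (v + k)) (hb : ∀ i, 0 < b i) (hc : ∀ j, 0 < c j)
    (h8 : (∑ j, c j) ≡ 0 [MOD 8]) {d d' : ℤ} (hd : IsCoprime d (level b c))
    (hd' : IsCoprime d' (level b c)) :
    kroneckerSymbol (charNumerator b c) (d * d') =
      kroneckerSymbol (charNumerator b c) d * kroneckerSymbol (charNumerator b c) d' := by
  have hdd : IsCoprime (d * d') (level b c) := hd.mul_left hd'
  obtain ⟨x, y, hxy⟩ := hd
  obtain ⟨x', y', hxy'⟩ := hd'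
  let γ : SL(2, ℤ) := ⟨!![x, -y; (level b c : ℤ), d], by rw [Matrix.det_fin_two_of]; linarith⟩
  let γ' : SL(2, ℤ) := ⟨!![x', -y'; (level b c : ℤ), d'], by rw [Matrix.det_fin_two_of]; linarith⟩
  have hγ : γ ∈ CongruenceSubgroup.Gamma0 (level b c) := mem_Gamma0_iff_dvd.mpr dvd_rfl
  have hγ' : γ' ∈ CongruenceSubgroup.Gamma0 (level b c) := mem_Gamma0_iff_dvd.mpr dvd_rfl
  have h11 : (γ * γ') 1 1 = level b c * (-y') + d * d' := by
    rw [Matrix.SpecialLinearGroup.coe_mul, Matrix.mul_apply, Fin.sum_univ_two]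
    rfl
  have k1 := mixedSeries_slash_eq hvk hb hc h8 hγ
  have k2 := mixedSeries_slash_eq hvk hb hc h8 hγ'
  have k3 := mixedSeries_slash_eq hvk hb hc h8 (mul_mem hγ hγ')
  rw [SlashAction.slash_mul, k1, ModularForm.SL_smul_slash, k2, smul_smul] at k3
  have k4 := smul_left_injective ℂ (mixedSeries_ne_zero hb hc) k3
  have k5 : kroneckerSymbol (charNumerator b c) (d * d') =
      kroneckerSymbol (charNumerator b c) ((γ * γ') 1 1) :=
    kroneckerSymbol_congr hvk hb hc h8 hdd (by rw [h11]; simp)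
  rw [k5]
  exact_mod_cast k4.symm

/-- The Kronecker symbol of the theorem is a Dirichlet character modulo the level. -/
lemma exists_dirichletCharacter (hvk : Even (v + k)) (hb : ∀ i, 0 < b i) (hc : ∀ j, 0 < c j)
    (h8 : (∑ j, c j) ≡ 0 [MOD 8]) :
    ∃ χ : DirichletCharacter ℂ (level b c), ∀ d : ℤ, IsCoprime d (level b c : ℤ) →
      χ (d : ZMod (level b c)) = (kroneckerSymbol (charNumerator b c) d : ℂ) := by
  have : NeZero (level b c) := ⟨(level_pos hb hc).ne'⟩
  have hcop : ∀ u : (ZMod (level b c))ˣ, IsCoprime (((u : ZMod (level b c)).val : ℕ) : ℤ)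
      (level b c) := fun u => Nat.isCoprime_iff_coprime.mpr (ZMod.val_coe_unit_coprime u)
  let f : (ZMod (level b c))ˣ →* ℂ :=
    { toFun := fun u => (kroneckerSymbol (charNumerator b c) (u : ZMod (level b c)).val : ℂ)
      map_one' := by
        have e : kroneckerSymbol (charNumerator b c)
            (((1 : (ZMod (level b c))ˣ) : ZMod (level b c)).val : ℤ) = 1 := by
          rw [kroneckerSymbol_congr hvk hb hc h8 (hcop 1) (d' := 1) (by simp)]
          have := kroneckerSymbol_natCast (charNumerator b c) odd_one
          rwa [Nat.cast_one, jacobiSym.one_right] at this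
        rw [e, Int.cast_one]
      map_mul' := fun u u' => by
        have e := kroneckerSymbol_congr hvk hb hc h8 (hcop (u * u'))
          (d' := ((u : ZMod (level b c)).val : ℤ) * ((u' : ZMod (level b c)).val : ℤ)) (by simp)
        rw [e, kroneckerSymbol_mul hvk hb hc h8 (hcop u) (hcop u')]
        push_cast
        rfl }
  refine ⟨MulChar.ofUnitHom f.toHomUnits, fun d hd => ?_⟩
  obtain ⟨u, hu⟩ : IsUnit (d : ZMod (level b c)) := (ZMod.coe_int_isUnit_iff_isCoprime d _).mpr
    hd.symm
  rw [← hu, MulChar.ofUnitHom_coe, MonoidHom.coe_toHomUnits]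
  show (kroneckerSymbol (charNumerator b c) (u : ZMod (level b c)).val : ℂ) = _
  rw [kroneckerSymbol_congr hvk hb hc h8 (hcop u) (d' := d) (by simpa using hu)]

end MixedForms

end

/-! ### The equivalence -/

/-- The left-hand side says: the Kronecker symbol defines (on integers prime to the level) a
Dirichlet character `χ` modulo the level, and the series is a modular form with character `χ`. -/
theorem theorem1p3 (v k : ℕ) (hv : 0 < v) (hk : 0 < k) (hvk : Even (v + k))
    (b : Fin v → ℕ) (c : Fin k → ℕ) (hb : ∀ i, 0 < b i) (hc : ∀ j, 0 < c j) :
    (∃ χ : DirichletCharacter ℂ (MixedForms.level b c),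
      (∀ d : ℤ, IsCoprime d (MixedForms.level b c : ℤ) →
        χ (d : ZMod (MixedForms.level b c)) =
          (MixedForms.kroneckerSymbol (MixedForms.charNumerator b c) d : ℂ)) ∧
      MixedForms.mixedSeries b c ∈
        MixedForms.modularFormsWithChar (((v + k) / 2 : ℕ) : ℤ) (MixedForms.level b c) χ) ↔
    (∑ j, c j) ≡ 0 [MOD 8] := by
  constructor
  · rintro ⟨χ, -, -, hF, -⟩
    -- T has lower right entry 1, where χ is 1 for any character, so e^{2πih/8} must be 1.
    have hT := hF ModularGroup.T (MixedForms.mem_Gamma0_iff_dvd.mpr (by simp [ModularGroup.T]))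
    have h11 : ModularGroup.T 1 1 = 1 := rfl
    rw [h11, Int.cast_one, map_one, MixedForms.mixedSeries_slash_T] at hT
    exact (MixedForms.exp_eq_one_iff_modEq _).mp
      (smul_left_injective ℂ (MixedForms.mixedSeries_ne_zero hb hc) hT)
  · intro h8
    obtain ⟨χ, hχ⟩ := MixedForms.exists_dirichletCharacter (b := b) hvk hb hc h8
    refine ⟨χ, hχ, MixedForms.mdifferentiable_mixedSeries hb hc, fun γ hγ => ?_,
      MixedForms.isBoundedAtImInfty_mixedSeries_slash hvk hb hc⟩
    rw [MixedForms.mixedSeries_slash_eq hvk hb hc h8 hγ, hχ _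
      ((MixedForms.isCoprime_lower_row γ).of_isCoprime_of_dvd_right
        (MixedForms.mem_Gamma0_iff_dvd.mp hγ))]
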